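/- Notation. Let $\nu\in\mathbb R\setminus\{0\}$, $\lambda=\operatorname{sgn}\nu$ (so $\lambda\nu=|\nu|>0$) and $g\in\mathbb R\setminus\{0\}$. A Trkalian field is a differentiable $\mathbf F:\mathbb R^3\to\mathbb C^3$ with $\nabla\times\mathbf F=\nu\mathbf F$. The Moses vectors are $$\mathbf Q_\lambda(\mathbf k)=-\frac{\lambda}{\sqrt2}\Big(\frac{k_1(k_1+i\lambda k_2)}{k(k+k_3)}-1,\ \frac{k_2(k_1+i\lambda k_2)}{k(k+k_3)}-i\lambda,\ \frac{k_1+i\lambda k_2}{k}\Big),\qquad k=|\mathbf k|\ne0,$$ with the value $-\frac{\lambda}{\sqrt2}(1,-i\lambda,0)$ if $k_3=-k$; they are unit vectors with $\mathbf k\times\mathbf Q_\lambda(\mathbf k)=-i\lambda k\,\mathbf Q_\lambda(\mathbf k)$. Let $d\Omega$ be the surface measure of the unit sphere $S^2\subset\mathbb R^3$. The Heisenberg distribution is $\delta^{+}(u)=\frac12\big[\delta(u)-\frac1{i\pi}\,\mathrm{P}\frac1u\big]$, and for a unit vector $\boldsymbol\theta$ $$\int_{S^2}G(\boldsymbol\kappa)\,\delta^+(\boldsymbol\kappa\cdot\boldsymbol\theta)\,d\Omega_{\boldsymbol\kappa}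 =\frac12\Big[\int_{C_{\boldsymbol\theta}}G\,d\ell-\frac1{i\pi}\lim_{\varepsilon\to0^+}\int_{|\boldsymbol\kappa\cdot\boldsymbol\theta|>\varepsilon}\frac{G(\boldsymbol\kappa)}{\boldsymbol\kappa\cdot\boldsymbol\theta}\,d\Omega_{\boldsymbol\kappa}\Big],$$ where $C_{\boldsymbol\theta}=S^2\cap\boldsymbol\theta^\perp$ carries arc length, so that the first term is half the Minkowski–Funk transform $\int_{S^2}G(\boldsymbol\kappa)\,\delta(\boldsymbol\kappa\cdot\boldsymbol\theta)\,d\Omega_{\boldsymbol\kappa}$ of $G$. Let $\mu$ be a finite measure on $S^2$, let $\boldsymbol\kappa\mapsto s_\lambda(\lambda\nu\boldsymbol\kappa)$ be $\mu$-integrable, and let $\mathbf F_\lambda$ be the Trkalian field with spherical Curl transform $s_\lambda\,d\mu$, that is $$\mathbf F_\lambda(\mathbf x)=\frac1{(2\pi)^{3/2}}\frac1g\int_{S^2}e^{i\lambda\nu\boldsymbol\kappa\cdot\mathbf x}\,\mathbf Q_\lambda(\boldsymbol\kappa)\,s_\lambda(\lambda\nu\boldsymbol\kappa)\,d\mu(\boldsymbol\kappa)\qquad(\mathbf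 x\in\mathbb R^3).$$ Proposition. Let $\mathbf x\in\mathbb R^3$. (1) Let $\mu=d\Omega$, let $|\boldsymbol\theta|=1$, and suppose that $\boldsymbol\kappa\mapsto s_\lambda(\lambda\nu\boldsymbol\kappa)\mathbf Q_\lambda(\boldsymbol\kappa)$ is Hölder continuous on $\{\boldsymbol\kappa\in S^2:|\boldsymbol\kappa\cdot\boldsymbol\theta|<\varepsilon\}$ for some $\varepsilon>0$. Then the divergent beam transform $\mathcal D\mathbf F_\lambda(\boldsymbol\theta,\mathbf x)=\int_0^\infty\mathbf F_\lambda(\mathbf x+t\boldsymbol\theta)\,dt$ exists as an improper integral, the principal value below exists, and $$\mathcal D\mathbf F_\lambda(\boldsymbol\theta,\mathbf x)=\frac1{(2\pi)^{1/2}}\frac1g\frac1{\lambda\nu}\int_{S^2}e^{i\lambda\nu\boldsymbol\kappa\cdot\mathbf x}\,\mathbf Q_\lambda(\boldsymbol\kappa)\,s_\lambda(\lambda\nu\boldsymbol\kappa)\,\delta^{+}(\boldsymbol\kappa\cdot\boldsymbol\theta)\,d\Omega_{\boldsymbol\kappa}.$$ (2) For every finite $\mu$ the same formula holds weakly in $\boldsymbol\theta$: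 for every Hölder continuous $\varphi:S^2\to\mathbb C$ the value $\Phi(\boldsymbol\kappa)=\int_{S^2}\varphi(\boldsymbol\theta)\,\delta^+(\boldsymbol\kappa\cdot\boldsymbol\theta)\,d\Omega_{\boldsymbol\theta}$ exists for every $\boldsymbol\kappa\in S^2$, all the integrals below converge absolutely, and $$\lim_{R\to\infty}\int_{S^2}\varphi(\boldsymbol\theta)\int_0^R\mathbf F_\lambda(\mathbf x+t\boldsymbol\theta)\,dt\,d\Omega_{\boldsymbol\theta}=\frac1{(2\pi)^{1/2}}\frac1g\frac1{\lambda\nu}\int_{S^2}e^{i\lambda\nu\boldsymbol\kappa\cdot\mathbf x}\,\mathbf Q_\lambda(\boldsymbol\kappa)\,s_\lambda(\lambda\nu\boldsymbol\kappa)\,\Phi(\boldsymbol\kappa)\,d\mu(\boldsymbol\kappa).$$ -/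

import Mathlib

open MeasureTheory Set Filter Topology
open scoped RealInnerProductSpace NNReal

noncomputable section

/-- Euclidean three-space. -/
abbrev E3 : Type := EuclideanSpace ℝ (Fin 3)

/-- The unit sphere of `E3`. -/
abbrev S2 : Type := Metric.sphere (0 : E3) 1

/-- The surface measure `dΩ` on the unit sphere (total mass `4π`). -/
def surfaceMeasure : Measure S2 := (volume : Measure E3).toSphere

/-- The partial derivative `∂ᵢ Fⱼ` at `x` of a complex vector field. -/
def partialD (F : E3 → Fin 3 → ℂ) (i j : Fin 3) (x : E3) : ℂ :=
  fderiv ℝ F x (EuclideanSpace.single i (1 : ℝ)) j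

/-- The curl of a complex vector field on `E3`. -/
def curl (F : E3 → Fin 3 → ℂ) (x : E3) : Fin 3 → ℂ :=
  ![partialD F 1 2 x - partialD F 2 1 x,
    partialD F 2 0 x - partialD F 0 2 x,
    partialD F 0 1 x - partialD F 1 0 x]

/-- Trkalian fields: eigenvectors of the curl operator, `∇ × F = ν F`. -/
def IsTrkalian (ν : ℝ) (F : E3 → Fin 3 → ℂ) : Prop :=
  Differentiable ℝ F ∧ ∀ x, curl F x = (ν : ℂ) • F x

open Classical in
/-- The Moses vectors `Q_λ(k)` (helicity `λ = ±1`, `k ≠ 0`): unit vectors, homogeneous of degree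
`0` in `k`, with `k × Q_λ(k) = -i λ |k| Q_λ(k)`. Moses' formula is undefined on the half-line
`k₃ = -|k|`; there the limit along the half-plane `k₂ = 0`, `k₁ > 0` is taken. -/
def mosesVector (lam : ℝ) (k : E3) : Fin 3 → ℂ :=
  (-(lam : ℂ) / (Real.sqrt 2 : ℂ)) •
    if ‖k‖ + k 2 = 0 then ![1, -Complex.I * lam, 0]
    else
      ![(k 0 : ℂ) * (k 0 + Complex.I * lam * k 1) / ((‖k‖ : ℂ) * (‖k‖ + k 2)) - 1,
        (k 1 : ℂ) * (k 0 + Complex.I * lam * k 1) / ((‖k‖ : ℂ) * (‖k‖ + k 2)) - Complex.I * lam,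
        ((k 0 : ℂ) + Complex.I * lam * k 1) / (‖k‖ : ℂ)]

/-- The plane wave `e^{i k·x}`. -/
def planeWave (k x : E3) : ℂ := Complex.exp (Complex.I * ((⟪k, x⟫ : ℝ) : ℂ))

/-- The helical curl eigenfunctions `χ_λ(x|k) = (2π)^{-3/2} e^{i k·x} Q_λ(k)`. -/
def curlEigenfunction (lam : ℝ) (x k : E3) : Fin 3 → ℂ :=
  ((((2 * Real.pi) ^ (-(3 / 2) : ℝ) : ℝ) : ℂ) * planeWave k x) • mosesVector lam k

/-- `F` is the field `F_λ(x) = (1/g) ∫ χ_λ(x|k) f_λ(k) d³k` whose Curl transform is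
`f_λ(k) = (δ(k - λν)/k²) s_λ(k)`, a layer on the sphere of radius `λν`. In polar coordinates
`k = λν κ` the measure `f_λ(k) d³k` is `s_λ(λν κ) dΩ_κ`. The measure `μ` replaces `dΩ`, so that
spherical Curl transforms which are measures (plane waves, for instance) are covered too; for
a function `s_λ` one takes `μ = surfaceMeasure`. -/
def HasSphericalCurlTransform (lam ν g : ℝ) (μ : Measure S2) (s : E3 → ℂ)
    (F : E3 → Fin 3 → ℂ) : Prop :=
  Integrable (fun κ : S2 => s ((lam * ν) • (κ : E3))) μ ∧
    ∀ x, F x = (1 / (g : ℂ)) • ∫ κ : S2,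
      s ((lam * ν) • (κ : E3)) • curlEigenfunction lam x ((lam * ν) • (κ : E3)) ∂μ

/-- The truncated half-line integral `∫₀ᴿ F(x + tθ) dt`. -/
def truncatedBeam (F : E3 → Fin 3 → ℂ) (θ x : E3) (R : ℝ) : Fin 3 → ℂ :=
  ∫ t in (0 : ℝ)..R, F (x + t • θ)

/-- The divergent beam transform `∫₀^∞ F(x + tθ) dt` exists, as an improper integral, and its
value is `D`. -/
def HasDivergentBeam (F : E3 → Fin 3 → ℂ) (θ x : E3) (D : Fin 3 → ℂ) : Prop :=
  (∀ R : ℝ, IntervalIntegrable (fun t : ℝ => F (x + t • θ)) volume 0 R) ∧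
    Tendsto (fun R : ℝ => truncatedBeam F θ x R) atTop (𝓝 D)

section Spherical

variable {V : Type*} [NormedAddCommGroup V] [NormedSpace ℂ V]

/-- The unit circle of the plane `θ^⊥`; for a unit vector `θ`, a great circle of the sphere. -/
abbrev greatCircle (θ : E3) : Type := Metric.sphere (0 : ((ℝ ∙ θ)ᗮ : Submodule ℝ E3)) 1

/-- Arc length on the great circle (total mass `2π`). -/
def arcLength (θ : E3) : Measure (greatCircle θ) :=
  (volume : Measure ((ℝ ∙ θ)ᗮ : Submodule ℝ E3)).toSphere

/-- The Minkowski-Funk transform `∫_{S²} G(κ) δ(κ·θ) dΩ_κ`: the integral of `G` over the great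
circle orthogonal to `θ`. -/
def minkowskiFunk (θ : E3) (G : E3 → V) : V :=
  ∫ ω : greatCircle θ, G ((ω : ((ℝ ∙ θ)ᗮ : Submodule ℝ E3)) : E3) ∂(arcLength θ)

/-- `P` is the principal value
`P.V. ∫_{S²} G(κ)/(κ·θ) dΩ_κ = lim_{ε → 0+} ∫_{|κ·θ| > ε} G(κ)/(κ·θ) dΩ_κ`. -/
def HasSphericalPV (θ : E3) (G : E3 → V) (P : V) : Prop :=
  (∀ ε : ℝ, 0 < ε → IntegrableOn (fun κ : S2 => ((⟪(κ : E3), θ⟫ : ℝ) : ℂ)⁻¹ • G κ)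
      {κ : S2 | ε < |⟪(κ : E3), θ⟫|} surfaceMeasure) ∧
    Tendsto (fun ε : ℝ => ∫ κ in {κ : S2 | ε < |⟪(κ : E3), θ⟫|},
      ((⟪(κ : E3), θ⟫ : ℝ) : ℂ)⁻¹ • G κ ∂surfaceMeasure) (𝓝[>] 0) (𝓝 P)

/-- `I` is the value of `∫_{S²} G(κ) δ⁺(κ·θ) dΩ_κ`, where
`δ⁺(u) = ½ (δ(u) - (1/(iπ)) P.V. (1/u))` is the Heisenberg distribution. -/
def HasHeisenbergIntegral (θ : E3) (G : E3 → V) (I : V) : Prop :=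
  Integrable (fun ω : greatCircle θ => G ((ω : ((ℝ ∙ θ)ᗮ : Submodule ℝ E3)) : E3))
      (arcLength θ) ∧
    ∃ P : V, HasSphericalPV θ G P ∧
      I = (1 / 2 : ℂ) • (minkowskiFunk θ G - (1 / (Complex.I * (Real.pi : ℂ))) • P)

/-- `G` is Hölder continuous (with some positive exponent) on the set `A`. -/
def IsHolderOn (G : E3 → V) (A : Set E3) : Prop :=
  ∃ C r : ℝ≥0, 0 < r ∧ HolderOnWith C r G A

end Spherical

/-- The amplitude `e^{iλν κ·x} Q_λ(κ) s_λ(λν κ)` as a function of `κ`. -/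
def mosesAmplitude (lam ν : ℝ) (s : E3 → ℂ) (x κ : E3) : Fin 3 → ℂ :=
  (planeWave ((lam * ν) • κ) x * s ((lam * ν) • κ)) • mosesVector lam κ

/-- The constant `(2π)^{-1/2} (1/g) (1/(λν))`. -/
def beamConstant (lam ν g : ℝ) : ℂ :=
  ((1 / Real.sqrt (2 * Real.pi) * (1 / g) * (1 / (lam * ν)) : ℝ) : ℂ)

end

/-! Integrating a plane wave along a ray produces the kernel K_T(u) = ∫₀ᵀ e^{itu} dt, so by Fubini
the truncated beam is the amplitude integrated over κ against K_T(κ·θ), with T = λνR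
(`truncatedBeam_eq`). The theorem says that K_T → 2πδ⁺ on the sphere.

By Archimedes' theorem (`map_spherePoint`), height along θ and position on the great circle carry
the product measure. Integrating G against a function of κ·θ thus becomes a one-dimensional integral
over u ∈ (-1, 1) against the latitude integral H(u), with h = H(0) the Minkowski-Funk transform. Off
u = 0 one has K_T(u) = i/u - i e^{iTu}/u. If (H - h)/u is integrable, the Riemann-Lebesgue lemma
gives ∫ K_T (H - h) → i ∫ (H - h)/u. The last integral is the principal value P of H/u because 1/u
is odd. Since ∫ K_T → π, the limit is πh + iP, which is 2π times the Heisenberg integral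
(`exists_hasHeisenbergIntegral_tendsto`).

Hölder continuity near the great circle makes the difference quotient O(|u|^{r-1}), hence
integrable. For the weak form Fubini moves the kernel onto φ, with κ as the axis. The same argument
applies to φ for every κ, and its estimates are uniform in κ, so dominated convergence in κ works
for any finite μ (`exists_weak_divergentBeam`). -/

noncomputable section

open scoped ENNReal

/-! ### Archimedes' theorem for the surface measure. -/

/-- Integration in polar coordinates for nonnegative functions. -/
theorem lintegral_eq_lintegral_toSphere {E : Type*} [NormedAddCommGroup E] [NormedSpace ℝ E]
    [MeasurableSpace E] [BorelSpace E] [FiniteDimensional ℝ E] [Nontrivial E] (μ : Measure E)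
    [μ.IsAddHaarMeasure] {f : E → ℝ≥0∞} (hf : Measurable f) :
    ∫⁻ x, f x ∂μ = ∫⁻ ω : Metric.sphere (0 : E) 1, (∫⁻ r in Ioi (0 : ℝ),
      ENNReal.ofReal (r ^ (Module.finrank ℝ E - 1)) * f (r • (ω : E))) ∂μ.toSphere := by
  have mp := (μ.measurePreserving_homeomorphUnitSphereProd)
  have e1 : ∫⁻ x, f x ∂μ = ∫⁻ x : ({0}ᶜ : Set E), f x ∂(μ.comap (↑)) := by
    rw [lintegral_subtype_comap (measurableSet_singleton _).compl f, restrict_compl_singleton]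
  rw [e1]
  have e2 := mp.lintegral_comp_emb (Homeomorph.measurableEmbedding _)
    (fun p => f ((p.2 : ℝ) • (p.1 : E)))
  have e3 : ∀ x : ({0}ᶜ : Set E), ((homeomorphUnitSphereProd E x).2 : ℝ) •
      ((homeomorphUnitSphereProd E x).1 : E) = x := fun x => by
    simpa using smul_inv_smul₀ (norm_ne_zero_iff.2 x.2) (x : E)
  simp only [e3] at e2
  have hm : Measurable fun p : Metric.sphere (0 : E) 1 × Ioi (0 : ℝ) =>
      f ((p.2 : ℝ) • (p.1 : E)) := by fun_prop
  rw [e2, lintegral_prod _ hm.aemeasurable]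
  congr 1 with ω
  rw [Measure.volumeIoiPow, lintegral_withDensity_eq_lintegral_mul _ (by fun_prop) (by fun_prop)]
  exact lintegral_subtype_comap measurableSet_Ioi
    (fun r : ℝ => ENNReal.ofReal (r ^ (Module.finrank ℝ E - 1)) * f (r • (ω : E)))

theorem lintegral_Ioo_sin_mul_comp_cos (f : ℝ → ℝ≥0∞) :
    ∫⁻ α in Ioo 0 Real.pi, ENNReal.ofReal (Real.sin α) * f (Real.cos α) =
      ∫⁻ u in Ioo (-1 : ℝ) 1, f u := by
  have himg : Real.cos '' Ioo 0 Real.pi = Ioo (-1) 1 := by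
    ext u
    constructor
    · rintro ⟨α, ⟨h0, h1⟩, rfl⟩
      have hs := Real.sin_pos_of_pos_of_lt_pi h0 h1
      have := Real.sin_sq_add_cos_sq α
      constructor <;> nlinarith
    · rintro ⟨h0, h1⟩
      refine ⟨Real.arccos u, ⟨Real.arccos_pos.2 h1, ?_⟩, Real.cos_arccos h0.le h1.le⟩
      exact lt_of_le_of_ne (Real.arccos_le_pi u) fun h => by
        rw [Real.arccos_eq_pi] at h; linarith
  rw [← himg, lintegral_image_eq_lintegral_abs_deriv_mul measurableSet_Ioo
    (fun x _ => (Real.hasDerivAt_cos x).hasDerivWithinAt)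
    (Real.injOn_cos.mono Ioo_subset_Icc_self)]
  refine setLIntegral_congr_fun measurableSet_Ioo fun α hα => ?_
  simp only [abs_neg]
  rw [abs_of_pos (Real.sin_pos_of_pos_of_lt_pi hα.1 hα.2)]

/-- Polar coordinates z = r cos α, ρ = r sin α: the weight ρ and the Jacobian r combine to r² sin α
dα, which is r² du for u = cos α. -/
theorem lintegral_halfPlane_eq {h : ℝ × ℝ → ℝ≥0∞} (hh : Measurable h) :
    ∫⁻ z : ℝ, ∫⁻ ρ in Ioi (0 : ℝ), ENNReal.ofReal ρ * h (z, ρ) =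
      ∫⁻ r in Ioi (0 : ℝ), ∫⁻ u in Ioo (-1 : ℝ) 1,
        ENNReal.ofReal (r ^ 2) * h (r * u, r * √(1 - u ^ 2)) := by
  -- Extending the integrand by zero to ρ ≤ 0 allows polar coordinates on the whole plane; the
  -- angles α ≤ 0 then contribute nothing.
  let g : ℝ × ℝ → ℝ≥0∞ := fun p => (Ioi (0 : ℝ)).indicator
    (fun ρ => ENNReal.ofReal ρ * h (p.1, ρ)) p.2
  have hg : Measurable g := by
    have : g = (Prod.snd ⁻¹' Ioi (0 : ℝ)).indicator fun p => ENNReal.ofReal p.2 * h p := by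
      ext p; simp [g, indicator]
    rw [this]
    exact Measurable.indicator (by fun_prop) (measurable_snd measurableSet_Ioi)
  have e1 : ∫⁻ z : ℝ, ∫⁻ ρ in Ioi (0 : ℝ), ENNReal.ofReal ρ * h (z, ρ) = ∫⁻ p, g p := by
    rw [Measure.volume_eq_prod, lintegral_prod _ hg.aemeasurable]
    congr 1 with z
    rw [← lintegral_indicator measurableSet_Ioi]
  have hpc : Measurable polarCoord.symm := continuous_polarCoord_symm.measurable
  rw [e1, ← lintegral_comp_polarCoord_symm,
    show polarCoord.target = Ioi (0 : ℝ) ×ˢ Ioo (-Real.pi) Real.pi from rfl, Measure.volume_eq_prod,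
    ← Measure.prod_restrict, lintegral_prod]
  swap
  · exact (measurable_fst.ennreal_ofReal.smul (hg.comp hpc)).aemeasurable
  refine setLIntegral_congr_fun measurableSet_Ioi fun r (hr : 0 < r) => ?_
  simp only
  rw [← lintegral_Ioo_sin_mul_comp_cos
    (fun u => ENNReal.ofReal (r ^ 2) * h (r * u, r * √(1 - u ^ 2)))]
  have hsub : Ioo 0 Real.pi ⊆ Ioo (-Real.pi) Real.pi :=
    Ioo_subset_Ioo_left (by linarith [Real.pi_pos])
  rw [← lintegral_indicator measurableSet_Ioo, ← lintegral_indicator measurableSet_Ioo]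
  congr 1 with α
  by_cases hα : α ∈ Ioo 0 Real.pi
  · have hs := Real.sin_pos_of_pos_of_lt_pi hα.1 hα.2
    have hsq : √(1 - Real.cos α ^ 2) = Real.sin α := by
      rw [← Real.sin_sq, Real.sqrt_sq hs.le]
    rw [indicator_of_mem (hsub hα), indicator_of_mem hα, hsq]
    have : (r * Real.sin α) ∈ Ioi (0 : ℝ) := mul_pos hr hs
    simp only [polarCoord_symm_apply, g, indicator_of_mem this, smul_eq_mul]
    rw [← mul_assoc, ← mul_assoc, ← ENNReal.ofReal_mul hr.le, ← ENNReal.ofReal_mul hs.le]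
    congr 2; ring
  · rw [indicator_of_notMem hα]
    by_cases hα' : α ∈ Ioo (-Real.pi) Real.pi
    · rw [indicator_of_mem hα']
      have hα0 : α ≤ 0 := by
        by_contra hc; exact hα ⟨not_le.1 hc, hα'.2⟩
      have : (r * Real.sin α) ∉ Ioi (0 : ℝ) := by
        have := Real.sin_nonpos_of_nonpos_of_neg_pi_le hα0 hα'.1.le
        simp only [mem_Ioi, not_lt]
        exact mul_nonpos_of_nonneg_of_nonpos hr.le this
      simp [polarCoord_symm_apply, g, indicator_of_notMem this]
    · rw [indicator_of_notMem hα']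

/-- The cylindrical decomposition of Euclidean space along a unit vector preserves volume. -/
theorem measurePreserving_smul_add_orthogonal {θ : E3} (hθ : ‖θ‖ = 1) :
    MeasurePreserving (fun p : ℝ × ((ℝ ∙ θ)ᗮ : Submodule ℝ E3) => p.1 • θ + (p.2 : E3))
      volume volume := by
  have h1 := (LinearIsometryEquiv.toSpanUnitSingleton (𝕜 := ℝ) θ hθ).measurePreserving
  have h2 := h1.prod (MeasurePreserving.id (volume : Measure ((ℝ ∙ θ)ᗮ : Submodule ℝ E3)))
  have h3 := WithLp.volume_preserving_toLp (ℝ ∙ θ) ((ℝ ∙ θ)ᗮ : Submodule ℝ E3)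
  have h4 := ((ℝ ∙ θ).orthogonalDecomposition.symm).measurePreserving
  have h5 := h4.comp (h3.comp h2)
  have h6 : (fun p : ℝ × ((ℝ ∙ θ)ᗮ : Submodule ℝ E3) => p.1 • θ + (p.2 : E3)) =
      (ℝ ∙ θ).orthogonalDecomposition.symm ∘ WithLp.toLp 2 ∘
        Prod.map (LinearIsometryEquiv.toSpanUnitSingleton (𝕜 := ℝ) θ hθ) id := by
    ext1 p
    simp
  rw [h6]
  exact h5

/-- The point of the unit sphere at height `u` over the point `ω` of the great circle. -/
def spherePoint (θ : E3) (p : greatCircle θ × ℝ) : E3 :=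
  p.2 • θ + √(1 - p.2 ^ 2) • ((p.1 : ((ℝ ∙ θ)ᗮ : Submodule ℝ E3)) : E3)

theorem continuous_spherePoint (θ : E3) : Continuous (spherePoint θ) := by
  unfold spherePoint
  fun_prop

theorem inner_greatCircle (θ : E3) (ω : greatCircle θ) :
    ⟪((ω : ((ℝ ∙ θ)ᗮ : Submodule ℝ E3)) : E3), θ⟫ = 0 :=
  Submodule.inner_left_of_mem_orthogonal (Submodule.mem_span_singleton_self θ) ω.1.2

theorem norm_greatCircle (θ : E3) (ω : greatCircle θ) :
    ‖((ω : ((ℝ ∙ θ)ᗮ : Submodule ℝ E3)) : E3)‖ = 1 := by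
  exact mem_sphere_zero_iff_norm.1 ω.2

theorem inner_spherePoint {θ : E3} (hθ : ‖θ‖ = 1) (p : greatCircle θ × ℝ) :
    ⟪spherePoint θ p, θ⟫ = p.2 := by
  simp [spherePoint, inner_add_left, real_inner_smul_left, inner_greatCircle, hθ]

theorem norm_spherePoint {θ : E3} (hθ : ‖θ‖ = 1) (p : greatCircle θ × ℝ) (hp : |p.2| ≤ 1) :
    ‖spherePoint θ p‖ = 1 := by
  have h0 : 0 ≤ 1 - p.2 ^ 2 := by nlinarith [abs_le.1 hp]
  have : ‖spherePoint θ p‖ ^ 2 = 1 := by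
    rw [spherePoint, @norm_add_sq_real, norm_smul, norm_smul, hθ, norm_greatCircle,
      real_inner_smul_left, real_inner_smul_right, real_inner_comm, inner_greatCircle]
    simp [abs_of_nonneg (Real.sqrt_nonneg _), Real.sq_sqrt h0]
  nlinarith [norm_nonneg (spherePoint θ p)]

theorem finrank_orthogonal_span_unit {θ : E3} (hθ : ‖θ‖ = 1) :
    Module.finrank ℝ ((ℝ ∙ θ)ᗮ : Submodule ℝ E3) = 2 := by
  have : Fact (Module.finrank ℝ E3 = 2 + 1) := ⟨by simp⟩
  exact Submodule.finrank_orthogonal_span_singleton (by rintro rfl; simp at hθ)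

/-- Space is split into the axis θ and its orthogonal plane. Polar coordinates in that plane leave a
half-plane integral over (z, ρ) for each ω, to which `lintegral_halfPlane_eq` applies. -/
theorem lintegral_cylinder {θ : E3} (hθ : ‖θ‖ = 1) {f : E3 → ℝ≥0∞} (hf : Measurable f) :
    ∫⁻ x, f x = ∫⁻ ω : greatCircle θ, (∫⁻ r in Ioi (0 : ℝ), ∫⁻ u in Ioo (-1 : ℝ) 1,
      ENNReal.ofReal (r ^ 2) * f (r • spherePoint θ (ω, u))) ∂(arcLength θ) := by
  have hfr := finrank_orthogonal_span_unit hθ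
  have : Nontrivial ((ℝ ∙ θ)ᗮ : Submodule ℝ E3) :=
    Module.nontrivial_of_finrank_pos (R := ℝ) (by omega)
  have mp := measurePreserving_smul_add_orthogonal hθ
  rw [← mp.lintegral_comp hf, Measure.volume_eq_prod, lintegral_prod _ (by fun_prop)]
  have e1 : ∀ z : ℝ, ∫⁻ y : ((ℝ ∙ θ)ᗮ : Submodule ℝ E3), f (z • θ + (y : E3)) =
      ∫⁻ ω : greatCircle θ, (∫⁻ ρ in Ioi (0 : ℝ), ENNReal.ofReal ρ *
        f (z • θ + ρ • ((ω : ((ℝ ∙ θ)ᗮ : Submodule ℝ E3)) : E3))) ∂(arcLength θ) := by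
    intro z
    rw [lintegral_eq_lintegral_toSphere volume (by fun_prop), hfr]
    simp [arcLength]
  simp only [e1]
  have : IsFiniteMeasure (arcLength θ) := by unfold arcLength; infer_instance
  rw [lintegral_lintegral_swap]
  swap
  · refine Measurable.aemeasurable ?_
    exact Measurable.lintegral_prod_right' (f := fun q : (ℝ × greatCircle θ) × ℝ =>
      ENNReal.ofReal q.2 * f (q.1.1 • θ + q.2 • ((q.1.2 : ((ℝ ∙ θ)ᗮ : Submodule ℝ E3)) : E3)))
      (by fun_prop)
  congr 1 with ω
  rw [lintegral_halfPlane_eq (h := fun p => f (p.1 • θ + p.2 • _)) (by fun_prop)]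
  simp [spherePoint, smul_add, smul_smul]

instance (θ : E3) : IsFiniteMeasure (arcLength θ) := by unfold arcLength; infer_instance

instance : IsFiniteMeasure surfaceMeasure := by unfold surfaceMeasure; infer_instance

/-- The volume integral of a product of a radial weight and f(x/‖x‖) is computed twice, in spherical
coordinates and by `lintegral_cylinder`. The weight is chosen with radial integral one, so only the
two angular integrals remain. -/
theorem lintegral_surfaceMeasure {θ : E3} (hθ : ‖θ‖ = 1) {f : E3 → ℝ≥0∞} (hf : Measurable f) :
    ∫⁻ κ : S2, f κ ∂surfaceMeasure = ∫⁻ ω : greatCircle θ, (∫⁻ u in Ioo (-1 : ℝ) 1,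
      f (spherePoint θ (ω, u))) ∂(arcLength θ) := by
  -- The factor r⁻² cancels the Jacobian, and the interval (1, 2) has length one and avoids the
  -- origin.
  let w : ℝ → ℝ≥0∞ := (Ioo (1 : ℝ) 2).indicator fun r => (ENNReal.ofReal (r ^ 2))⁻¹
  have hw : Measurable w := Measurable.indicator (by fun_prop) measurableSet_Ioo
  have hc : ∀ a : ℝ≥0∞, ∫⁻ r in Ioi (0 : ℝ), ENNReal.ofReal (r ^ 2) * (w r * a) = a := by
    intro a
    have : ∀ r ∈ Ioi (0 : ℝ), ENNReal.ofReal (r ^ 2) * (w r * a) =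
        (Ioo (1 : ℝ) 2).indicator (fun _ => a) r := by
      intro r (hr : 0 < r)
      by_cases h : r ∈ Ioo (1 : ℝ) 2
      · simp only [w, indicator_of_mem h]
        rw [← mul_assoc, ENNReal.mul_inv_cancel (by simpa using hr.ne') (by simp), one_mul]
      · simp [w, indicator_of_notMem h]
    rw [setLIntegral_congr_fun measurableSet_Ioi this, lintegral_indicator measurableSet_Ioo,
      Measure.restrict_restrict measurableSet_Ioo, inter_eq_self_of_subset_left
        (show Ioo (1 : ℝ) 2 ⊆ Ioi 0 from fun r hr => lt_trans one_pos hr.1)]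
    simp; norm_num
  let g : E3 → ℝ≥0∞ := fun x => w ‖x‖ * f (‖x‖⁻¹ • x)
  have hg : Measurable g := by
    have h1 : Measurable fun x : E3 => ‖x‖⁻¹ • x := by fun_prop
    exact (hw.comp measurable_norm).mul (hf.comp h1)
  have hgr : ∀ (r : ℝ), 0 < r → ∀ y : E3, ‖y‖ = 1 → g (r • y) = w r * f y := by
    intro r hr y hy
    simp only [g, norm_smul, hy, Real.norm_eq_abs, abs_of_pos hr, mul_one, smul_smul,
      inv_mul_cancel₀ hr.ne', one_smul]
  have e1 := lintegral_eq_lintegral_toSphere (volume : Measure E3) hg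
  have e2 := lintegral_cylinder hθ hg
  have e3 : ∫⁻ x, g x = ∫⁻ κ : S2, f κ ∂surfaceMeasure := by
    rw [e1]
    change _ = ∫⁻ κ : S2, f κ ∂(volume : Measure E3).toSphere
    congr 1 with κ
    rw [← hc (f κ)]
    refine setLIntegral_congr_fun measurableSet_Ioi fun r hr => ?_
    simp only [finrank_euclideanSpace, Fintype.card_fin]
    rw [hgr r hr κ (by simp)]
  rw [← e3, e2]
  congr 1 with ω
  rw [lintegral_lintegral_swap]
  swap
  · refine Measurable.aemeasurable ?_
    have := (continuous_spherePoint θ).measurable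
    have h1 : Measurable fun q : ℝ × ℝ => q.1 • spherePoint θ (ω, q.2) :=
      measurable_fst.smul (this.comp (by fun_prop))
    exact Measurable.mul (by fun_prop) (hg.comp h1)
  refine setLIntegral_congr_fun measurableSet_Ioo fun u hu => ?_
  rw [← hc (f (spherePoint θ (ω, u)))]
  refine setLIntegral_congr_fun measurableSet_Ioi fun r hr => ?_
  rw [hgr r hr _ (norm_spherePoint hθ _ (abs_le.2 ⟨hu.1.le, hu.2.le⟩))]

/-- Archimedes' theorem: in the coordinates `(ω, u)` the surface measure of the sphere is the
product of arc length and Lebesgue measure. -/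
theorem map_spherePoint {θ : E3} (hθ : ‖θ‖ = 1) :
    ((arcLength θ).prod (volume.restrict (Ioo (-1 : ℝ) 1))).map (spherePoint θ) =
      surfaceMeasure.map Subtype.val := by
  have hm := (continuous_spherePoint θ).measurable
  refine Measure.ext_of_lintegral _ fun f hf => ?_
  rw [lintegral_map hf hm, lintegral_map hf measurable_subtype_coe,
    lintegral_surfaceMeasure hθ hf,
    lintegral_prod (fun p => f (spherePoint θ p)) (hf.comp hm).aemeasurable]

end

/-! ### The kernel on the line and its limit 2πδ⁺. -/

noncomputable section

/-- The truncated half-line Fourier kernel `∫₀ᵀ e^{itu} dt`; it tends to `2π δ⁺(u)`. -/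
def beamKernel (T u : ℝ) : ℂ := ∫ t in (0 : ℝ)..T, Complex.exp (Complex.I * ((t * u : ℝ) : ℂ))

theorem norm_exp_I_mul_ofReal (y : ℝ) : ‖Complex.exp (Complex.I * (y : ℂ))‖ = 1 := by
  rw [mul_comm, Complex.norm_exp_ofReal_mul_I]

theorem beamKernel_of_ne_zero (T : ℝ) {u : ℝ} (hu : u ≠ 0) :
    beamKernel T u =
      Complex.I * (u : ℂ)⁻¹ - Complex.I * Complex.exp (Complex.I * ((T * u : ℝ) : ℂ)) * (u : ℂ)⁻¹ := by
  have hu' : (u : ℂ) ≠ 0 := by exact_mod_cast hu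
  have h : ∀ t : ℝ, Complex.exp (Complex.I * ((t * u : ℝ) : ℂ)) =
      Complex.exp (Complex.I * u * t) := fun t => by push_cast; ring_nf
  simp only [beamKernel, h]
  rw [integral_exp_mul_complex (mul_ne_zero Complex.I_ne_zero hu')]
  field_simp
  simp only [Complex.ofReal_zero, mul_zero, Complex.exp_zero, Complex.I_sq]
  ring

theorem norm_beamKernel_le (T u : ℝ) : ‖beamKernel T u‖ ≤ |T| := by
  have := intervalIntegral.norm_integral_le_of_norm_le_const (a := 0) (b := T) (C := 1)
    (f := fun t => Complex.exp (Complex.I * ((t * u : ℝ) : ℂ)))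
    (fun t _ => (norm_exp_I_mul_ofReal _).le)
  simpa [beamKernel] using this

theorem norm_beamKernel_le_inv (T u : ℝ) (hu : u ≠ 0) : ‖beamKernel T u‖ ≤ 2 * ‖(u : ℂ)⁻¹‖ := by
  rw [beamKernel_of_ne_zero T hu]
  refine (norm_sub_le _ _).trans (le_of_eq ?_)
  simp only [norm_mul, Complex.norm_I, norm_exp_I_mul_ofReal]
  ring

theorem continuous_beamKernel (T : ℝ) : Continuous (beamKernel T) := by
  unfold beamKernel
  exact intervalIntegral.continuous_parametric_intervalIntegral_of_continuous' (by fun_prop) _ _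

variable {V : Type*} [NormedAddCommGroup V] [NormedSpace ℂ V]

/-- The Riemann-Lebesgue lemma in the normalisation e^{iTu}. It holds for every f, since the
integrals of a non-integrable function are zero by convention. -/
theorem tendsto_integral_exp_I_smul_atTop (f : ℝ → V) :
    Tendsto (fun T : ℝ => ∫ u : ℝ, Complex.exp (Complex.I * ((T * u : ℝ) : ℂ)) • f u) atTop
      (𝓝 0) := by
  have h := Real.tendsto_integral_exp_smul_cocompact f
  have h2 : Tendsto (fun T : ℝ => -(2 * Real.pi)⁻¹ * T) atTop (cocompact ℝ) :=
    (tendsto_id.const_mul_atTop_of_neg (by simp [Real.pi_pos])).mono_right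
      atBot_le_cocompact
  refine (h.comp h2).congr fun T => ?_
  simp only [Function.comp]
  congr 1 with u
  rw [Circle.smul_def, Real.fourierChar_apply]
  congr 2
  have : (Real.pi : ℂ) ≠ 0 := by exact_mod_cast Real.pi_ne_zero
  push_cast
  field_simp

theorem ae_ne_zero_real (s : Set ℝ) : ∀ᵐ u ∂(volume.restrict s : Measure ℝ), u ≠ 0 :=
  ae_restrict_of_ae (by simp [ae_iff])

/-- The kernel is i/u minus i e^{iTu}/u, and the oscillating term vanishes in the limit by
Riemann-Lebesgue. -/
theorem tendsto_setIntegral_beamKernel_smul [CompleteSpace V] {s : Set ℝ} (hs : MeasurableSet s)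
    {G : ℝ → V} (hG : IntegrableOn (fun u : ℝ => (u : ℂ)⁻¹ • G u) s) :
    Tendsto (fun T : ℝ => ∫ u in s, beamKernel T u • G u) atTop
      (𝓝 (Complex.I • ∫ u in s, (u : ℂ)⁻¹ • G u)) := by
  have h := tendsto_integral_exp_I_smul_atTop (s.indicator fun u : ℝ => (u : ℂ)⁻¹ • G u)
  have h1 := ((h.const_smul Complex.I).const_sub (Complex.I • ∫ u in s, (u : ℂ)⁻¹ • G u))
  rw [smul_zero, sub_zero] at h1
  refine h1.congr fun T => ?_
  have e : ∀ u : ℝ, Complex.exp (Complex.I * ((T * u : ℝ) : ℂ)) •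
      s.indicator (fun u : ℝ => (u : ℂ)⁻¹ • G u) u = s.indicator
        (fun u : ℝ => Complex.exp (Complex.I * ((T * u : ℝ) : ℂ)) • (u : ℂ)⁻¹ • G u) u := by
    intro u
    by_cases hu : u ∈ s <;> simp [hu]
  simp only [e]
  have hi : IntegrableOn
      (fun u : ℝ => Complex.exp (Complex.I * ((T * u : ℝ) : ℂ)) • (u : ℂ)⁻¹ • G u) s :=
    Integrable.bdd_smul hG 1 (Continuous.aestronglyMeasurable (by fun_prop))
      (Eventually.of_forall fun u => (norm_exp_I_mul_ofReal _).le)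
  rw [integral_indicator hs, ← integral_smul, ← integral_smul, ← integral_sub]
  · refine integral_congr_ae ((ae_ne_zero_real s).mono fun u hu => ?_)
    simp only [beamKernel_of_ne_zero T hu, sub_smul, mul_smul]
  · exact hG.smul _
  · exact hi.smul _

theorem integral_eq_zero_of_odd {f : ℝ → V} (hf : ∀ u, f (-u) = -f u) :
    ∫ u, f u = 0 := by
  have h := integral_neg_eq_self f volume
  simp only [hf, integral_neg] at h
  have h2 : (2 : ℝ) • ∫ u, f u = 0 := by
    rw [two_smul]
    nth_rewrite 1 [← h]
    exact neg_add_cancel _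
  exact (smul_eq_zero.1 h2).resolve_left two_ne_zero

theorem integral_exp_I_mul_gaussian (t : ℝ) :
    ∫ u : ℝ, Complex.exp (Complex.I * ((t * u : ℝ) : ℂ)) * ((Real.exp (-(1 / 4) * u ^ 2) : ℝ) : ℂ) =
      ((2 * √Real.pi * Real.exp (-1 * t ^ 2) : ℝ) : ℂ) := by
  have h := fourierIntegral_gaussian (b := 1 / 4) (by norm_num) t
  have e1 : ((Real.pi : ℂ) / (1 / 4)) ^ (1 / 2 : ℂ) = ((2 * √Real.pi : ℝ) : ℂ) := by
    have : ((Real.pi : ℂ) / (1 / 4)) = ((4 * Real.pi : ℝ) : ℂ) := by push_cast; ring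
    rw [this, show (1 / 2 : ℂ) = ((1 / 2 : ℝ) : ℂ) by push_cast; rfl,
      ← Complex.ofReal_cpow (by positivity), ← Real.sqrt_eq_rpow,
      Real.sqrt_mul (by norm_num), show (4 : ℝ) = 2 ^ 2 by norm_num, Real.sqrt_sq (by norm_num)]
  rw [e1] at h
  convert h using 1
  · congr 1 with u
    push_cast
    ring_nf
  · push_cast
    ring_nf

theorem integrable_exp_neg_quarter_sq : Integrable fun u : ℝ => Real.exp (-(1 / 4) * u ^ 2) :=
  integrable_exp_neg_mul_sq (by norm_num)

/-- Fubini turns the integral into ∫₀ᵀ of the Gaussian's Fourier transform 2√π e^{-t²}, whose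
integral over the half-line is π. -/
theorem tendsto_integral_beamKernel_mul_gaussian :
    Tendsto (fun T : ℝ => ∫ u : ℝ, beamKernel T u * ((Real.exp (-(1 / 4) * u ^ 2) : ℝ) : ℂ)) atTop
      (𝓝 (Real.pi : ℂ)) := by
  have e : ∀ T : ℝ, ∫ u : ℝ, beamKernel T u * ((Real.exp (-(1 / 4) * u ^ 2) : ℝ) : ℂ) =
      ((∫ t in (0 : ℝ)..T, 2 * √Real.pi * Real.exp (-1 * t ^ 2) : ℝ) : ℂ) := by
    intro T
    simp only [beamKernel]
    rw [← intervalIntegral.integral_ofReal]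
    simp only [← integral_exp_I_mul_gaussian]
    rw [intervalIntegral_integral_swap]
    · simp only [intervalIntegral.integral_mul_const]
    · have : IsFiniteMeasure (volume.restrict (Set.uIoc 0 T)) := ⟨by simp [Set.uIoc]⟩
      have h1 : Integrable (fun p : ℝ × ℝ => ((Real.exp (-(1 / 4) * p.2 ^ 2) : ℝ) : ℂ))
          ((volume.restrict (Set.uIoc 0 T)).prod volume) :=
        (integrable_exp_neg_quarter_sq.ofReal (𝕜 := ℂ)).comp_snd _
      exact Integrable.bdd_mul (c := 1) h1 (Continuous.aestronglyMeasurable (by fun_prop))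
        (Eventually.of_forall fun p => (norm_exp_I_mul_ofReal _).le)
  simp only [e]
  have hint : Integrable fun t : ℝ => 2 * √Real.pi * Real.exp (-1 * t ^ 2) :=
    (integrable_exp_neg_mul_sq one_pos).const_mul _
  have h := intervalIntegral_tendsto_integral_Ioi 0 hint.integrableOn tendsto_id
  rw [integral_const_mul, integral_gaussian_Ioi, div_one] at h
  have hpi : 2 * √Real.pi * (√Real.pi / 2) = Real.pi := by
    have := Real.mul_self_sqrt Real.pi_pos.le
    linarith
  rw [hpi] at h
  exact (Complex.continuous_ofReal.tendsto _).comp h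

/-- Comparison of the indicator χ of (-1, 1) with a Gaussian γ equal to 1 at the origin: (γ - χ)/u
is integrable and odd, so its integral is zero and the limits for γ and χ agree. -/
theorem tendsto_setIntegral_beamKernel :
    Tendsto (fun T : ℝ => ∫ u in Ioo (-1 : ℝ) 1, beamKernel T u) atTop (𝓝 (Real.pi : ℂ)) := by
  let γ : ℝ → ℂ := fun u => ((Real.exp (-(1 / 4) * u ^ 2) : ℝ) : ℂ)
  let χ : ℝ → ℂ := (Ioo (-1 : ℝ) 1).indicator fun _ => 1
  have hγ : Integrable γ := integrable_exp_neg_quarter_sq.ofReal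
  have hχ : Integrable χ :=
    (integrable_indicator_iff measurableSet_Ioo).2 (integrableOn_const (by simp))
  have hint : Integrable fun u : ℝ => (u : ℂ)⁻¹ • (γ u - χ u) := by
    refine Integrable.mono' (hγ.norm.add hχ.norm) ?_ (Eventually.of_forall fun u => ?_)
    · exact (Complex.measurable_ofReal.inv.aestronglyMeasurable).smul
        (hγ.sub hχ).aestronglyMeasurable
    · simp only [Pi.add_apply, norm_smul, norm_inv, Complex.norm_real, Real.norm_eq_abs]
      by_cases hu : u ∈ Ioo (-1 : ℝ) 1
      · have hu1 : |u| ≤ 1 := (abs_lt.2 hu).le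
        simp only [χ, indicator_of_mem hu, norm_one]
        have h1 : ‖γ u - 1‖ ≤ |u| := by
          have e1 : γ u - 1 = ((Real.exp (-(1 / 4) * u ^ 2) - 1 : ℝ) : ℂ) := by simp [γ]
          rw [e1, Complex.norm_real, Real.norm_eq_abs, abs_le]
          have h2 := Real.add_one_le_exp (-(1 / 4) * u ^ 2)
          have h3 : Real.exp (-(1 / 4) * u ^ 2) ≤ 1 := Real.exp_le_one_iff.2 (by nlinarith)
          have h4 := abs_nonneg u
          have h5 : u ^ 2 = |u| * |u| := by rw [← sq, sq_abs]
          constructor <;> nlinarith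
        have h2 : |u|⁻¹ * ‖γ u - 1‖ ≤ |u|⁻¹ * |u| :=
          mul_le_mul_of_nonneg_left h1 (by positivity)
        linarith [inv_mul_le_one (a := |u|), norm_nonneg (γ u)]
      · simp only [χ, indicator_of_notMem hu, sub_zero, norm_zero, add_zero]
        have hu1 : 1 ≤ |u| := by
          by_contra hc; exact hu (abs_lt.1 (not_le.1 hc))
        exact mul_le_of_le_one_left (norm_nonneg _) (inv_le_one_of_one_le₀ hu1)
  have hodd : ∫ u : ℝ, (u : ℂ)⁻¹ • (γ u - χ u) = 0 := by
    refine integral_eq_zero_of_odd fun u => ?_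
    have h1 : γ (-u) = γ u := by simp [γ]
    have h2 : χ (-u) = χ u := by
      have : -u ∈ Ioo (-1 : ℝ) 1 ↔ u ∈ Ioo (-1 : ℝ) 1 := by
        simp only [mem_Ioo]; constructor <;> rintro ⟨h, h'⟩ <;> constructor <;> linarith
      by_cases hu : u ∈ Ioo (-1 : ℝ) 1
      · simp only [χ, indicator_of_mem hu, indicator_of_mem (this.2 hu)]
      · simp only [χ, indicator_of_notMem hu, indicator_of_notMem (mt this.1 hu)]
    rw [h1, h2]
    push_cast
    rw [inv_neg, neg_smul]
  have h := tendsto_setIntegral_beamKernel_smul MeasurableSet.univ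
    (G := fun u => γ u - χ u) hint.integrableOn
  simp only [Measure.restrict_univ, hodd, smul_zero] at h
  have h2 := tendsto_integral_beamKernel_mul_gaussian.sub h
  rw [sub_zero] at h2
  refine h2.congr fun T => ?_
  have hb : ∀ f : ℝ → ℂ, Integrable f → Integrable fun u => beamKernel T u * f u := fun f hf =>
    Integrable.bdd_mul (c := |T|) hf (continuous_beamKernel T).aestronglyMeasurable
      (Eventually.of_forall fun u => norm_beamKernel_le T u)
  simp only [smul_eq_mul, mul_sub]
  rw [integral_sub (hb γ hγ) (hb χ hχ), sub_sub_cancel, ← integral_indicator measurableSet_Ioo]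
  congr 1 with u
  by_cases hu : u ∈ Ioo (-1 : ℝ) 1 <;> simp [χ, hu]

/-- Principal values on `(-1, 1)`: the constant `h` contributes nothing. -/
theorem tendsto_setIntegral_inv_smul [CompleteSpace V] {H : ℝ → V} {h : V}
    (hH : IntegrableOn (fun u : ℝ => (u : ℂ)⁻¹ • (H u - h)) (Ioo (-1) 1)) :
    Tendsto (fun ε : ℝ => ∫ u in Ioo (-1 : ℝ) 1 ∩ {u | ε < |u|}, (u : ℂ)⁻¹ • H u) (𝓝[>] 0)
      (𝓝 (∫ u in Ioo (-1 : ℝ) 1, (u : ℂ)⁻¹ • (H u - h))) := by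
  have hms : ∀ ε : ℝ, MeasurableSet {u : ℝ | ε < |u|} := fun ε =>
    measurableSet_lt measurable_const (by fun_prop)
  have h1 : Tendsto (fun ε : ℝ => ∫ u in Ioo (-1 : ℝ) 1,
      {u : ℝ | ε < |u|}.indicator (fun u : ℝ => (u : ℂ)⁻¹ • (H u - h)) u) (𝓝[>] 0)
      (𝓝 (∫ u in Ioo (-1 : ℝ) 1, (u : ℂ)⁻¹ • (H u - h))) := by
    refine tendsto_integral_filter_of_dominated_convergence
      (fun u => ‖(u : ℂ)⁻¹ • (H u - h)‖) (Eventually.of_forall fun ε => ?_)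
      (Eventually.of_forall fun ε => Eventually.of_forall fun u => norm_indicator_le_norm_self _ _)
      hH.norm ((ae_ne_zero_real _).mono fun u hu => ?_)
    · exact hH.aestronglyMeasurable.indicator (hms ε)
    · refine tendsto_const_nhds.congr' ?_
      have : ∀ᶠ ε in 𝓝[>] (0 : ℝ), ε < |u| :=
        mem_nhdsWithin_of_mem_nhds (Iio_mem_nhds (abs_pos.2 hu))
      filter_upwards [this] with ε hε
      rw [indicator_of_mem (show u ∈ {u : ℝ | ε < |u|} from hε)]
  refine h1.congr' ?_
  filter_upwards [self_mem_nhdsWithin] with ε (hε : 0 < ε)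
  rw [integral_indicator (hms ε), Measure.restrict_restrict (hms ε), inter_comm]
  set S := Ioo (-1 : ℝ) 1 ∩ {u | ε < |u|} with hS
  have hSm : MeasurableSet S := measurableSet_Ioo.inter (hms ε)
  have hc : IntegrableOn (fun u : ℝ => (u : ℂ)⁻¹ • h) S := by
    refine Integrable.mono' (g := fun _ => ε⁻¹ * ‖h‖) ?_
      (Measurable.aestronglyMeasurable (by fun_prop) |>.smul_const h) ?_
    · exact integrableOn_const
        ((measure_mono inter_subset_left).trans_lt (by simp : volume (Ioo (-1 : ℝ) 1) < ⊤)).ne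
    · refine (ae_restrict_mem hSm).mono fun u hu => ?_
      rw [norm_smul, norm_inv, Complex.norm_real, Real.norm_eq_abs]
      have : ε < |u| := hu.2
      gcongr
  -- The cutoff set is symmetric and 1/u is odd, so subtracting the constant h leaves the truncated
  -- integrals unchanged.
  have hz : ∫ u in S, (u : ℂ)⁻¹ • h = 0 := by
    rw [← integral_indicator hSm]
    refine integral_eq_zero_of_odd fun u => ?_
    have : -u ∈ S ↔ u ∈ S := by
      simp only [hS, mem_inter_iff, mem_Ioo, mem_ofPred_eq, abs_neg]
      constructor <;> rintro ⟨⟨h, h'⟩, h''⟩ <;> refine ⟨⟨by linarith, by linarith⟩, h''⟩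
    by_cases hu : u ∈ S
    · rw [indicator_of_mem hu, indicator_of_mem (this.2 hu)]
      push_cast
      rw [inv_neg, neg_smul]
    · rw [indicator_of_notMem hu, indicator_of_notMem (mt this.1 hu), neg_zero]
  have hH2 : IntegrableOn (fun u : ℝ => (u : ℂ)⁻¹ • (H u - h)) S := hH.mono_set inter_subset_left
  rw [← add_zero (∫ u in S, _), ← hz, ← integral_add hH2 hc]
  congr 1 with u
  rw [← smul_add, sub_add_cancel]

theorem setIntegral_beamKernel_smul_eq [CompleteSpace V] {H : ℝ → V} (h : V)
    (hH : IntegrableOn H (Ioo (-1) 1)) (T : ℝ) :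
    ∫ u in Ioo (-1 : ℝ) 1, beamKernel T u • H u =
      (∫ u in Ioo (-1 : ℝ) 1, beamKernel T u • (H u - h)) +
        (∫ u in Ioo (-1 : ℝ) 1, beamKernel T u) • h := by
  have hk : ∀ f : ℝ → V, IntegrableOn f (Ioo (-1) 1) →
      IntegrableOn (fun u => beamKernel T u • f u) (Ioo (-1) 1) := fun f hf =>
    Integrable.bdd_smul hf |T| (continuous_beamKernel T).aestronglyMeasurable
      (Eventually.of_forall fun u => norm_beamKernel_le T u)
  have hc : IntegrableOn (fun _ : ℝ => h) (Ioo (-1) 1) := integrableOn_const (by simp)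
  have hs : IntegrableOn (fun u => H u - h) (Ioo (-1) 1) := hH.sub hc
  rw [← integral_smul_const, ← integral_add (hk _ hs) (hk _ hc)]
  congr 1 with u
  rw [← smul_add]
  simp

theorem tendsto_setIntegral_beamKernel_smul_of_inv_smul_sub [CompleteSpace V] {H : ℝ → V} {h : V}
    (hH : IntegrableOn H (Ioo (-1) 1))
    (hH' : IntegrableOn (fun u : ℝ => (u : ℂ)⁻¹ • (H u - h)) (Ioo (-1) 1)) :
    Tendsto (fun T : ℝ => ∫ u in Ioo (-1 : ℝ) 1, beamKernel T u • H u) atTop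
      (𝓝 ((Real.pi : ℂ) • h + Complex.I • ∫ u in Ioo (-1 : ℝ) 1, (u : ℂ)⁻¹ • (H u - h))) := by
  simp only [setIntegral_beamKernel_smul_eq h hH]
  rw [add_comm]
  exact (tendsto_setIntegral_beamKernel_smul measurableSet_Ioo hH').add
    (tendsto_setIntegral_beamKernel.smul_const h)

/-- Uses |K_T(u)| ≤ 2/|u| on the difference H - h. The bound depends on T only through the
convergent quantity ∫ K_T, which provides the domination for the weak limit. -/
theorem norm_setIntegral_beamKernel_smul_le [CompleteSpace V] {H : ℝ → V} {h : V}
    (hH : IntegrableOn H (Ioo (-1) 1))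
    (hH' : IntegrableOn (fun u : ℝ => (u : ℂ)⁻¹ • (H u - h)) (Ioo (-1) 1)) (T : ℝ) :
    ‖∫ u in Ioo (-1 : ℝ) 1, beamKernel T u • H u‖ ≤
      2 * (∫ u in Ioo (-1 : ℝ) 1, ‖(u : ℂ)⁻¹ • (H u - h)‖) +
        ‖∫ u in Ioo (-1 : ℝ) 1, beamKernel T u‖ * ‖h‖ := by
  rw [setIntegral_beamKernel_smul_eq h hH]
  refine (norm_add_le _ _).trans (add_le_add ?_ (norm_smul _ _).le)
  rw [← integral_const_mul]
  refine norm_integral_le_of_norm_le (hH'.norm.const_mul 2)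
    ((ae_ne_zero_real _).mono fun u hu => ?_)
  rw [norm_smul, norm_smul, ← mul_assoc]
  exact mul_le_mul_of_nonneg_right (norm_beamKernel_le_inv T u hu) (norm_nonneg _)

end

/-! ### From the sphere to the line: latitude integrals and Heisenberg integrals. -/

noncomputable section

variable {V : Type*} [NormedAddCommGroup V] [NormedSpace ℂ V]

/-- The inclusion of the great circle into space. -/
abbrev greatCircleIncl (θ : E3) (ω : greatCircle θ) : E3 :=
  ((ω : ((ℝ ∙ θ)ᗮ : Submodule ℝ E3)) : E3)

/-- The coordinate measure `dℓ du` on the cylinder over the great circle. -/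
abbrev cylinderMeasure (θ : E3) : Measure (greatCircle θ × ℝ) :=
  (arcLength θ).prod (volume.restrict (Ioo (-1 : ℝ) 1))

theorem measurableEmbedding_sphere : MeasurableEmbedding (Subtype.val : S2 → E3) :=
  MeasurableEmbedding.subtype_coe Metric.isClosed_sphere.measurableSet

theorem integrable_comp_spherePoint {W : Type*} [NormedAddCommGroup W] {θ : E3} (hθ : ‖θ‖ = 1)
    {G : E3 → W}
    (hG : Integrable (fun κ : S2 => G κ) surfaceMeasure) :
    Integrable (fun p => G (spherePoint θ p)) (cylinderMeasure θ) := by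
  have h : Integrable G (surfaceMeasure.map Subtype.val) :=
    measurableEmbedding_sphere.integrable_map_iff.2 hG
  rw [← map_spherePoint hθ] at h
  exact h.comp_measurable (continuous_spherePoint θ).measurable

theorem integral_surfaceMeasure {θ : E3} (hθ : ‖θ‖ = 1) {G : E3 → V}
    (hG : Integrable (fun κ : S2 => G κ) surfaceMeasure) :
    ∫ κ : S2, G κ ∂surfaceMeasure = ∫ p, G (spherePoint θ p) ∂(cylinderMeasure θ) := by
  have h : Integrable G (surfaceMeasure.map Subtype.val) :=
    measurableEmbedding_sphere.integrable_map_iff.2 hG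
  rw [← measurableEmbedding_sphere.integral_map]
  rw [← map_spherePoint hθ] at h ⊢
  rw [integral_map (continuous_spherePoint θ).measurable.aemeasurable h.aestronglyMeasurable]

/-- The integral of `G` over the circle of latitude at height `u`. -/
def latitudeIntegral (θ : E3) (G : E3 → V) (u : ℝ) : V :=
  ∫ ω, G (spherePoint θ (ω, u)) ∂(arcLength θ)

theorem integrableOn_latitudeIntegral {θ : E3} (hθ : ‖θ‖ = 1) {G : E3 → V}
    (hG : Integrable (fun κ : S2 => G κ) surfaceMeasure) :
    IntegrableOn (latitudeIntegral θ G) (Ioo (-1) 1) :=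
  (integrable_comp_spherePoint hθ hG).integral_prod_right

theorem integrable_inner_smul {θ : E3} {G : E3 → V}
    (hG : Integrable (fun κ : S2 => G κ) surfaceMeasure) {c : ℝ → ℂ} (hc : Measurable c) {M : ℝ}
    (hM : ∀ u, ‖c u‖ ≤ M) :
    Integrable (fun κ : S2 => c ⟪(κ : E3), θ⟫ • G κ) surfaceMeasure := by
  have h1 : Measurable fun κ : S2 => ⟪(κ : E3), θ⟫ := by fun_prop
  exact Integrable.bdd_smul hG M (hc.comp h1).aestronglyMeasurable
    (Eventually.of_forall fun κ => hM _)

/-- By Archimedes' theorem the weight c(κ·θ) is constant on each circle of latitude. It is applied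
both to the kernel and to the truncations of 1/u. -/
theorem integral_inner_smul {θ : E3} (hθ : ‖θ‖ = 1) {G : E3 → V}
    (hG : Integrable (fun κ : S2 => G κ) surfaceMeasure) {c : ℝ → ℂ} (hc : Measurable c) {M : ℝ}
    (hM : ∀ u, ‖c u‖ ≤ M) :
    ∫ κ : S2, c ⟪(κ : E3), θ⟫ • G κ ∂surfaceMeasure =
      ∫ u in Ioo (-1 : ℝ) 1, c u • latitudeIntegral θ G u := by
  have hI := integrable_inner_smul (θ := θ) hG hc hM
  rw [integral_surfaceMeasure hθ (G := fun x => c ⟪x, θ⟫ • G x) hI]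
  have h2 := integrable_comp_spherePoint hθ (G := fun x => c ⟪x, θ⟫ • G x) hI
  rw [integral_prod_symm _ h2]
  congr 1 with u
  simp only [inner_spherePoint hθ, latitudeIntegral, integral_smul]

/-- The difference quotient in the height `u` between `G` and its value on the great circle. -/
def latitudeQuotient (θ : E3) (G : E3 → V) (p : greatCircle θ × ℝ) : V :=
  (p.2 : ℂ)⁻¹ • (G (spherePoint θ p) - G (greatCircleIncl θ p.1))

section Main

variable {θ : E3} {G : E3 → V}

theorem integral_latitudeQuotient_ae (hθ : ‖θ‖ = 1)
    (hG : Integrable (fun κ : S2 => G κ) surfaceMeasure)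
    (hC : Integrable (fun ω => G (greatCircleIncl θ ω)) (arcLength θ)) :
    (fun u : ℝ => ∫ ω, latitudeQuotient θ G (ω, u) ∂(arcLength θ))
      =ᵐ[volume.restrict (Ioo (-1 : ℝ) 1)]
      fun u : ℝ => (u : ℂ)⁻¹ • (latitudeIntegral θ G u - minkowskiFunk θ G) := by
  filter_upwards [(integrable_comp_spherePoint hθ hG).prod_left_ae] with u hu
  simp only [latitudeQuotient, latitudeIntegral, minkowskiFunk]
  rw [integral_smul, integral_sub hu hC]

theorem integrableOn_inv_smul_latitudeIntegral_sub (hθ : ‖θ‖ = 1)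
    (hG : Integrable (fun κ : S2 => G κ) surfaceMeasure)
    (hC : Integrable (fun ω => G (greatCircleIncl θ ω)) (arcLength θ))
    (hW : Integrable (latitudeQuotient θ G) (cylinderMeasure θ)) :
    IntegrableOn (fun u : ℝ => (u : ℂ)⁻¹ • (latitudeIntegral θ G u - minkowskiFunk θ G))
      (Ioo (-1) 1) :=
  hW.integral_prod_right.congr (integral_latitudeQuotient_ae hθ hG hC)

theorem integral_norm_inv_smul_latitudeIntegral_sub_le (hθ : ‖θ‖ = 1)
    (hG : Integrable (fun κ : S2 => G κ) surfaceMeasure)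
    (hC : Integrable (fun ω => G (greatCircleIncl θ ω)) (arcLength θ))
    (hW : Integrable (latitudeQuotient θ G) (cylinderMeasure θ)) :
    ∫ u in Ioo (-1 : ℝ) 1, ‖(u : ℂ)⁻¹ • (latitudeIntegral θ G u - minkowskiFunk θ G)‖ ≤
      ∫ p, ‖latitudeQuotient θ G p‖ ∂(cylinderMeasure θ) := by
  rw [integral_prod_symm _ hW.norm]
  refine integral_mono_ae (integrableOn_inv_smul_latitudeIntegral_sub hθ hG hC hW).norm
    hW.norm.integral_prod_right ?_
  filter_upwards [integral_latitudeQuotient_ae hθ hG hC] with u hu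
  rw [← hu]
  exact norm_integral_le_integral_norm _

/-- The one-dimensional results are applied to H = `latitudeIntegral θ G` and h = `minkowskiFunk θ
G`; integrability of the quotient on the cylinder passes to (H - h)/u by integrating over ω. -/
theorem exists_hasHeisenbergIntegral_tendsto [CompleteSpace V] (hθ : ‖θ‖ = 1)
    (hG : Integrable (fun κ : S2 => G κ) surfaceMeasure)
    (hC : Integrable (fun ω => G (greatCircleIncl θ ω)) (arcLength θ))
    (hW : Integrable (latitudeQuotient θ G) (cylinderMeasure θ)) :
    ∃ I : V, HasHeisenbergIntegral θ G I ∧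
      Tendsto (fun T : ℝ => ∫ κ : S2, beamKernel T ⟪(κ : E3), θ⟫ • G κ ∂surfaceMeasure) atTop
        (𝓝 ((2 * Real.pi : ℂ) • I)) := by
  have hH := integrableOn_latitudeIntegral hθ hG
  have hH' := integrableOn_inv_smul_latitudeIntegral_sub hθ hG hC hW
  set P : V := ∫ u in Ioo (-1 : ℝ) 1, (u : ℂ)⁻¹ • (latitudeIntegral θ G u - minkowskiFunk θ G)
    with hP
  refine ⟨(1 / 2 : ℂ) • (minkowskiFunk θ G - (1 / (Complex.I * (Real.pi : ℂ))) • P),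
    ⟨hC, P, ?_, rfl⟩, ?_⟩
  · let c : ℝ → ℝ → ℂ := fun ε => {u : ℝ | ε < |u|}.indicator fun u => (u : ℂ)⁻¹
    have hms : ∀ ε : ℝ, MeasurableSet {u : ℝ | ε < |u|} := fun ε =>
      measurableSet_lt measurable_const (by fun_prop)
    have hmS : ∀ ε : ℝ, MeasurableSet {κ : S2 | ε < |⟪(κ : E3), θ⟫|} := fun ε =>
      measurableSet_lt measurable_const (by fun_prop)
    have hcm : ∀ ε, Measurable (c ε) := fun ε => Complex.measurable_ofReal.inv.indicator (hms ε)
    have hcb : ∀ ε, 0 < ε → ∀ u, ‖c ε u‖ ≤ ε⁻¹ := by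
      intro ε hε u
      by_cases hu : ε < |u|
      · simp only [c, indicator_of_mem (show u ∈ {u : ℝ | ε < |u|} from hu), norm_inv,
          Complex.norm_real, Real.norm_eq_abs]
        gcongr
      · simp only [c, indicator_of_notMem (show u ∉ {u : ℝ | ε < |u|} from hu), norm_zero]
        positivity
    have hce : ∀ ε, (fun κ : S2 => c ε ⟪(κ : E3), θ⟫ • G κ) =
        {κ : S2 | ε < |⟪(κ : E3), θ⟫|}.indicator
          (fun κ : S2 => ((⟪(κ : E3), θ⟫ : ℝ) : ℂ)⁻¹ • G κ) := by
      intro ε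
      ext κ
      by_cases hκ : ε < |⟪(κ : E3), θ⟫| <;> simp [c, hκ]
    constructor
    · intro ε hε
      have := integrable_inner_smul (θ := θ) hG (hcm ε) (hcb ε hε)
      rw [hce] at this
      exact (integrable_indicator_iff (hmS ε)).1 this
    · refine (tendsto_setIntegral_inv_smul hH').congr' ?_
      filter_upwards [self_mem_nhdsWithin] with ε (hε : 0 < ε)
      have := integral_inner_smul hθ hG (hcm ε) (hcb ε hε)
      rw [hce, integral_indicator (hmS ε)] at this
      rw [this, inter_comm, ← Measure.restrict_restrict (hms ε), ← integral_indicator (hms ε)]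
      congr 1 with u
      by_cases hu : ε < |u| <;> simp [c, hu]
  · have h := tendsto_setIntegral_beamKernel_smul_of_inv_smul_sub hH hH'
    -- The coefficients agree because 2π · ½ = π and -2π · ½ · 1/(iπ) = -1/i = i.
    have e : (Real.pi : ℂ) • minkowskiFunk θ G + Complex.I • P = (2 * Real.pi : ℂ) •
        (1 / 2 : ℂ) • (minkowskiFunk θ G - (1 / (Complex.I * (Real.pi : ℂ))) • P) := by
      have hpi : (Real.pi : ℂ) ≠ 0 := by exact_mod_cast Real.pi_ne_zero
      rw [smul_smul, smul_sub, smul_smul, sub_eq_add_neg, ← neg_smul]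
      congr 2
      · ring
      · field_simp
        simp
    rw [← hP, e] at h
    refine h.congr fun T => ?_
    rw [integral_inner_smul hθ hG (continuous_beamKernel T).measurable (norm_beamKernel_le T)]

theorem norm_integral_beamKernel_inner_smul_le [CompleteSpace V] (hθ : ‖θ‖ = 1)
    (hG : Integrable (fun κ : S2 => G κ) surfaceMeasure)
    (hC : Integrable (fun ω => G (greatCircleIncl θ ω)) (arcLength θ))
    (hW : Integrable (latitudeQuotient θ G) (cylinderMeasure θ)) (T : ℝ) :
    ‖∫ κ : S2, beamKernel T ⟪(κ : E3), θ⟫ • G κ ∂surfaceMeasure‖ ≤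
      2 * (∫ p, ‖latitudeQuotient θ G p‖ ∂(cylinderMeasure θ)) +
        ‖∫ u in Ioo (-1 : ℝ) 1, beamKernel T u‖ * ‖minkowskiFunk θ G‖ := by
  rw [integral_inner_smul hθ hG (continuous_beamKernel T).measurable (norm_beamKernel_le T)]
  refine (norm_setIntegral_beamKernel_smul_le (integrableOn_latitudeIntegral hθ hG)
    (integrableOn_inv_smul_latitudeIntegral_sub hθ hG hC hW) T).trans ?_
  gcongr
  exact integral_norm_inv_smul_latitudeIntegral_sub_le hθ hG hC hW

end Main

/-! ### Hölder bounds for the difference quotient. -/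

theorem integrableOn_abs_rpow {s : ℝ} (hs : -1 < s) :
    IntegrableOn (fun u : ℝ => |u| ^ s) (Ioo (-1) 1) := by
  have h1 : IntervalIntegrable (fun u : ℝ => |u| ^ s) volume 0 1 := by
    refine (intervalIntegral.intervalIntegrable_rpow' hs).congr fun u hu => ?_
    rw [uIoc_of_le zero_le_one] at hu
    simp [abs_of_pos hu.1]
  have h2 : IntervalIntegrable (fun u : ℝ => |u| ^ s) volume (-1) 0 := by
    have := (IntervalIntegrable.iff_comp_neg (f := fun u : ℝ => |u| ^ s)).1 h1
    simp only [abs_neg, neg_zero] at this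
    exact this.symm
  have h3 := h2.trans h1
  rw [intervalIntegrable_iff_integrableOn_Ioo_of_le (by norm_num)] at h3
  exact h3

/-- The displacement has a component u along θ and 1 - √(1 - u²) ≤ u² ≤ |u| along the circle point,
whence the factor 2. -/
theorem norm_spherePoint_sub_le (θ : E3) (hθ : ‖θ‖ = 1) (p : greatCircle θ × ℝ) (hp : |p.2| ≤ 1) :
    ‖spherePoint θ p - greatCircleIncl θ p.1‖ ≤ 2 * |p.2| := by
  have h0 : 0 ≤ 1 - p.2 ^ 2 := by nlinarith [abs_le.1 hp]
  have e : spherePoint θ p - greatCircleIncl θ p.1 =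
      p.2 • θ + (√(1 - p.2 ^ 2) - 1) • greatCircleIncl θ p.1 := by
    simp only [spherePoint, sub_smul, one_smul]
    abel
  rw [e]
  refine (norm_add_le _ _).trans ?_
  rw [norm_smul, norm_smul, hθ, norm_greatCircle, mul_one, mul_one, Real.norm_eq_abs,
    Real.norm_eq_abs]
  have h1 : √(1 - p.2 ^ 2) ≤ 1 := Real.sqrt_le_one.2 (by nlinarith [sq_nonneg p.2])
  have h2 : 1 - p.2 ^ 2 ≤ √(1 - p.2 ^ 2) := by
    have := Real.sqrt_nonneg (1 - p.2 ^ 2)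
    nlinarith [Real.sq_sqrt h0]
  have h3 : |√(1 - p.2 ^ 2) - 1| ≤ |p.2| := by
    rw [abs_of_nonpos (by linarith)]
    have : p.2 ^ 2 = |p.2| * |p.2| := by rw [← sq, sq_abs]
    nlinarith [abs_nonneg p.2]
  linarith

theorem norm_latitudeQuotient_le {θ : E3} {G : E3 → V} {C r : ℝ} (p : greatCircle θ × ℝ)
    (hp0 : p.2 ≠ 0)
    (hp : ‖G (spherePoint θ p) - G (greatCircleIncl θ p.1)‖ ≤ C * |p.2| ^ r) :
    ‖latitudeQuotient θ G p‖ ≤ C * |p.2| ^ (r - 1) := by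
  rw [latitudeQuotient, norm_smul, norm_inv, Complex.norm_real, Real.norm_eq_abs,
    Real.rpow_sub_one (abs_ne_zero.2 hp0)]
  have : 0 < |p.2| := abs_pos.2 hp0
  calc |p.2|⁻¹ * ‖G (spherePoint θ p) - G (greatCircleIncl θ p.1)‖
      ≤ |p.2|⁻¹ * (C * |p.2| ^ r) := by gcongr
    _ = C * (|p.2| ^ r / |p.2|) := by field_simp

theorem ae_cylinderMeasure (θ : E3) : ∀ᵐ p ∂(cylinderMeasure θ), p.2 ≠ 0 ∧ |p.2| < 1 := by
  have h : ∀ᵐ u ∂(volume.restrict (Ioo (-1 : ℝ) 1)), u ≠ 0 ∧ |u| < 1 := by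
    filter_upwards [ae_ne_zero_real (Ioo (-1 : ℝ) 1), ae_restrict_mem measurableSet_Ioo] with u h1 h2
    exact ⟨h1, abs_lt.2 h2⟩
  exact Measure.quasiMeasurePreserving_snd.ae h

/-- Near the great circle the Hölder bound gives C|u|^{r-1}, integrable since r > 0. Where |u| ≥ δ
the factor 1/|u| is at most 1/δ and integrability of G suffices. -/
theorem integrable_latitudeQuotient {θ : E3} (hθ : ‖θ‖ = 1) {G : E3 → V} {C r δ : ℝ}
    (hr : 0 < r) (hC0 : 0 ≤ C) (hδ : 0 < δ)
    (hG : Integrable (fun κ : S2 => G κ) surfaceMeasure)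
    (hC : Integrable (fun ω => G (greatCircleIncl θ ω)) (arcLength θ))
    (hH : ∀ p : greatCircle θ × ℝ, |p.2| < δ → |p.2| < 1 →
      ‖G (spherePoint θ p) - G (greatCircleIncl θ p.1)‖ ≤ C * |p.2| ^ r) :
    Integrable (latitudeQuotient θ G) (cylinderMeasure θ) := by
  have hG' := integrable_comp_spherePoint hθ hG
  have hC' : Integrable (fun p : greatCircle θ × ℝ => G (greatCircleIncl θ p.1))
      (cylinderMeasure θ) := hC.comp_fst _
  have hu : Integrable (fun p : greatCircle θ × ℝ => C * |p.2| ^ (r - 1)) (cylinderMeasure θ) :=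
    Integrable.const_mul
      (Integrable.comp_snd (integrableOn_abs_rpow (s := r - 1) (by linarith)) _) C
  refine Integrable.mono' (hu.add ((hG'.norm.add hC'.norm).const_mul δ⁻¹)) ?_ ?_
  · have : Measurable fun p : greatCircle θ × ℝ => (p.2 : ℂ)⁻¹ := by fun_prop
    exact this.aestronglyMeasurable.smul (hG'.sub hC').aestronglyMeasurable
  · filter_upwards [ae_cylinderMeasure θ] with p ⟨hp0, hp1⟩
    simp only [Pi.add_apply]
    by_cases hp : |p.2| < δ
    · have h1 := norm_latitudeQuotient_le p hp0 (hH p hp hp1)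
      have h2 : 0 ≤ δ⁻¹ * (‖G (spherePoint θ p)‖ + ‖G (greatCircleIncl θ p.1)‖) := by positivity
      linarith
    · have h2 : 0 ≤ C * |p.2| ^ (r - 1) := by positivity
      have h3 : ‖latitudeQuotient θ G p‖ ≤
          δ⁻¹ * (‖G (spherePoint θ p)‖ + ‖G (greatCircleIncl θ p.1)‖) := by
        rw [latitudeQuotient, norm_smul, norm_inv, Complex.norm_real, Real.norm_eq_abs]
        have := not_lt.1 hp
        gcongr
        exact norm_sub_le _ _
      linarith

theorem integral_norm_latitudeQuotient_le {θ : E3} {G : E3 → V} {C r : ℝ} (hr : 0 < r)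
    (hH : ∀ p : greatCircle θ × ℝ, |p.2| < 1 →
      ‖G (spherePoint θ p) - G (greatCircleIncl θ p.1)‖ ≤ C * |p.2| ^ r) :
    ∫ p, ‖latitudeQuotient θ G p‖ ∂(cylinderMeasure θ) ≤
      (arcLength θ).real univ * (C * ∫ u in Ioo (-1 : ℝ) 1, |u| ^ (r - 1)) := by
  have hi := integrableOn_abs_rpow (s := r - 1) (by linarith)
  have hu : Integrable (fun p : greatCircle θ × ℝ => C * |p.2| ^ (r - 1)) (cylinderMeasure θ) :=
    Integrable.const_mul (Integrable.comp_snd hi _) C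
  calc ∫ p, ‖latitudeQuotient θ G p‖ ∂(cylinderMeasure θ)
      ≤ ∫ p, C * |p.2| ^ (r - 1) ∂(cylinderMeasure θ) := by
        refine integral_mono_of_nonneg (Eventually.of_forall fun p => norm_nonneg _) hu ?_
        filter_upwards [ae_cylinderMeasure θ] with p ⟨hp0, hp1⟩
        exact norm_latitudeQuotient_le p hp0 (hH p hp1)
    _ = _ := by
        rw [integral_const_mul, integral_fun_snd (fun u : ℝ => |u| ^ (r - 1)), smul_eq_mul]
        ring

/-- Archimedes' theorem for a constant function: area is length times 2. It shows that the length
does not depend on θ, as the uniform bound requires. -/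
theorem arcLength_real_univ {θ : E3} (hθ : ‖θ‖ = 1) :
    (arcLength θ).real univ = surfaceMeasure.real (univ : Set S2) / 2 := by
  have h := integral_surfaceMeasure hθ (G := fun _ => (1 : ℂ)) (integrable_const _)
  simp only [integral_const] at h
  have h1 : (cylinderMeasure θ).real univ = (arcLength θ).real univ * 2 := by
    rw [← univ_prod_univ, measureReal_prod_prod]
    simp; norm_num
  rw [h1] at h
  have h2 : surfaceMeasure.real (univ : Set S2) = (arcLength θ).real univ * 2 := by
    simpa using congrArg Complex.re h
  linarith

end

/-! ### Moses vectors, plane waves and the truncated beam. -/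

noncomputable section

theorem mosesVector_smul (lam : ℝ) {a : ℝ} (ha : 0 < a) (k : E3) :
    mosesVector lam (a • k) = mosesVector lam k := by
  have ha' : (a : ℂ) ≠ 0 := by exact_mod_cast ha.ne'
  have hn : ‖a • k‖ = a * ‖k‖ := by rw [norm_smul, Real.norm_eq_abs, abs_of_pos ha]
  have hc : ∀ i, (a • k) i = a * k i := fun i => by simp
  have hz : (a * ‖k‖ + a * k 2 = 0) ↔ (‖k‖ + k 2 = 0) := by
    rw [← mul_add, mul_eq_zero]
    exact ⟨fun h => h.resolve_left ha.ne', Or.inr⟩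
  unfold mosesVector
  simp only [hn, hc, hz]
  have h1 : ∀ z : ℝ, ((a * z : ℝ) : ℂ) * ((a * k 0 : ℝ) + Complex.I * lam * (a * k 1 : ℝ)) /
      (((a * ‖k‖ : ℝ) : ℂ) * ((a * ‖k‖ : ℝ) + (a * k 2 : ℝ))) =
      z * (k 0 + Complex.I * lam * k 1) / (‖k‖ * (‖k‖ + k 2)) := by
    intro z
    push_cast
    rw [← mul_div_mul_left ((z : ℂ) * (k 0 + Complex.I * lam * k 1)) _ (mul_ne_zero ha' ha')]
    ring_nf
  have h2 : (((a * k 0 : ℝ) : ℂ) + Complex.I * lam * (a * k 1 : ℝ)) / ((a * ‖k‖ : ℝ) : ℂ) =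
      (k 0 + Complex.I * lam * k 1) / ‖k‖ := by
    push_cast
    rw [← mul_div_mul_left ((k 0 : ℂ) + Complex.I * lam * k 1) _ ha']
    ring_nf
  simp only [h1, h2]

/-- A crude bound in the sup norm of `Fin 3 → ℂ`, enough for domination. The apparent singularity at
k₃ = -1 is harmless: with w = k₁ + iλk₂ and |z| ≤ |w|, |zw|/(1 + k₃) ≤ (1 - k₃²)/(1 + k₃) = 1 - k₃ ≤
2. -/
theorem norm_mosesVector_le {lam : ℝ} (hl : |lam| = 1) {k : E3} (hk : ‖k‖ = 1) :
    ‖mosesVector lam k‖ ≤ 3 := by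
  have hsq : k 0 ^ 2 + k 1 ^ 2 + k 2 ^ 2 = 1 := by
    have := EuclideanSpace.real_norm_sq_eq k
    rw [hk, Fin.sum_univ_three] at this
    linarith
  have hl2 : lam ^ 2 = 1 := by rw [← sq_abs, hl]; norm_num
  have hw : ‖(k 0 : ℂ) + Complex.I * lam * k 1‖ ^ 2 = k 0 ^ 2 + k 1 ^ 2 := by
    rw [← Complex.normSq_eq_norm_sq, Complex.normSq_apply]
    simp
    linear_combination (k 1 ^ 2) * hl2
  set w : ℂ := (k 0 : ℂ) + Complex.I * lam * k 1 with hwdef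
  have hw0 := norm_nonneg w
  have hc : ‖-(lam : ℂ) / (Real.sqrt 2 : ℂ)‖ ≤ 1 := by
    rw [norm_div, norm_neg, Complex.norm_real, Complex.norm_real, Real.norm_eq_abs, hl,
      Real.norm_eq_abs, abs_of_nonneg (Real.sqrt_nonneg _)]
    refine div_le_one_of_le₀ (Real.one_le_sqrt.2 (by norm_num)) (Real.sqrt_nonneg _)
  have hIl : ‖Complex.I * (lam : ℂ)‖ = 1 := by simp [hl]
  have hnIl : ‖-(Complex.I * (lam : ℂ))‖ = 1 := by rw [norm_neg, hIl]
  unfold mosesVector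
  rw [norm_smul]
  refine (mul_le_of_le_one_left (norm_nonneg _) hc).trans ?_
  rw [pi_norm_le_iff_of_nonneg (by norm_num)]
  split_ifs with h
  · intro i
    fin_cases i
    · simp
    · simp [hl]
    · simp
  · rw [hk] at h ⊢
    have hk2 : |k 2| ≤ 1 := by
      rw [abs_le]; constructor <;> nlinarith [sq_nonneg (k 0), sq_nonneg (k 1)]
    have hpos : 0 < 1 + k 2 := lt_of_le_of_ne (by linarith [(abs_le.1 hk2).1]) (Ne.symm h)
    have hw1 : ‖w‖ ≤ 1 := by nlinarith [sq_nonneg (k 2)]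
    have key : ∀ z : ℝ, z ^ 2 ≤ k 0 ^ 2 + k 1 ^ 2 →
        ‖(z : ℂ) * w / (((1 : ℝ) : ℂ) * (((1 : ℝ) : ℂ) + k 2))‖ ≤ 2 := by
      intro z hz
      have e : (((1 : ℝ) : ℂ) * (((1 : ℝ) : ℂ) + k 2)) = ((1 + k 2 : ℝ) : ℂ) := by push_cast; ring
      rw [e, norm_div, norm_mul, Complex.norm_real, Complex.norm_real, Real.norm_eq_abs,
        Real.norm_eq_abs, abs_of_pos hpos, div_le_iff₀ hpos]
      have h1 : |z| ≤ ‖w‖ := abs_le_of_sq_le_sq (by rw [hw]; exact hz) hw0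
      nlinarith [(abs_le.1 hk2).2, (abs_le.1 hk2).1, mul_le_mul_of_nonneg_right h1 hw0]
    intro i
    fin_cases i
    · refine (norm_sub_le _ _).trans ?_
      have := key (k 0) (by nlinarith [sq_nonneg (k 1)])
      rw [norm_one]
      linarith
    · refine (norm_sub_le _ _).trans ?_
      have := key (k 1) (by nlinarith [sq_nonneg (k 0)])
      rw [hIl]
      linarith
    · change ‖w / ((1 : ℝ) : ℂ)‖ ≤ 3
      rw [Complex.ofReal_one, div_one]
      linarith

theorem measurable_mosesVector (lam : ℝ) : Measurable (mosesVector lam) := by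
  unfold mosesVector
  refine Measurable.const_smul (M := ℂ) (X := Fin 3 → ℂ) ?_ _
  refine Measurable.ite ?_ measurable_const ?_
  · exact measurableSet_eq_fun (by fun_prop) measurable_const
  · refine measurable_pi_iff.2 fun i => ?_
    fin_cases i
    · simp; fun_prop
    · simp; fun_prop
    · simp; fun_prop

theorem continuous_planeWave (a : ℝ) (x : E3) : Continuous fun κ : E3 => planeWave (a • κ) x := by
  unfold planeWave
  fun_prop

theorem norm_planeWave (k x : E3) : ‖planeWave k x‖ = 1 := norm_exp_I_mul_ofReal _

theorem norm_planeWave_sub_le (k l x : E3) :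
    ‖planeWave k x - planeWave l x‖ ≤ ‖k - l‖ * ‖x‖ := by
  have e : planeWave k x - planeWave l x =
      planeWave l x * (Complex.exp (Complex.I * ((⟪k - l, x⟫ : ℝ) : ℂ)) - 1) := by
    unfold planeWave
    rw [mul_sub, mul_one, ← Complex.exp_add, inner_sub_left]
    congr 2
    push_cast
    ring
  rw [e, norm_mul, norm_planeWave, one_mul]
  exact Real.norm_exp_I_mul_ofReal_sub_one_le.trans (abs_real_inner_le_norm _ _)

theorem planeWave_add_smul (a t : ℝ) (κ x θ : E3) :
    planeWave (a • κ) (x + t • θ) =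
      Complex.exp (Complex.I * ((t * (a * ⟪κ, θ⟫) : ℝ) : ℂ)) * planeWave (a • κ) x := by
  unfold planeWave
  rw [← Complex.exp_add]
  congr 1
  simp only [inner_add_right, real_inner_smul_left, real_inner_smul_right]
  push_cast
  ring

/-- Rescaling time by a = λν; the factor 1/(λν) of the final constant arises here. -/
theorem beamKernel_mul {a : ℝ} (ha : a ≠ 0) (R u : ℝ) :
    beamKernel R (a * u) = (a : ℂ)⁻¹ * beamKernel (a * R) u := by
  unfold beamKernel
  have h := intervalIntegral.integral_comp_mul_left (a := 0) (b := R)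
    (fun t : ℝ => Complex.exp (Complex.I * ((t * u : ℝ) : ℂ))) ha
  rw [mul_zero, Complex.real_smul, Complex.ofReal_inv] at h
  rw [← h]
  congr 1 with t
  ring_nf

theorem integrable_mosesAmplitude {lam ν : ℝ} (hl : |lam| = 1) {μ : Measure S2}
    {s : E3 → ℂ} (hs : Integrable (fun κ : S2 => s ((lam * ν) • (κ : E3))) μ) (x : E3) :
    Integrable (fun κ : S2 => mosesAmplitude lam ν s x κ) μ := by
  refine Integrable.mono' (g := fun κ : S2 => ‖s ((lam * ν) • (κ : E3))‖ * 3)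
    (hs.norm.mul_const 3) ?_ (Eventually.of_forall fun κ => ?_)
  · have h1 : Continuous fun κ : S2 => planeWave ((lam * ν) • (κ : E3)) x :=
      (continuous_planeWave _ x).comp continuous_subtype_val
    exact (h1.aestronglyMeasurable.mul hs.aestronglyMeasurable).smul
      ((measurable_mosesVector lam).comp measurable_subtype_coe).aestronglyMeasurable
  · rw [mosesAmplitude, norm_smul, norm_mul, norm_planeWave, one_mul]
    gcongr
    exact norm_mosesVector_le hl (by simp)

/-- The constant `(1/g) (2π)^{-3/2} / a`. -/
def truncatedBeamConstant (a g : ℝ) : ℂ :=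
  (1 / (g : ℂ)) * (((2 * Real.pi) ^ (-(3 / 2) : ℝ) : ℝ) : ℂ) * (a : ℂ)⁻¹

/-- The factor 2π comes from the limit 2πδ⁺ of the kernel and turns (2π)^{-3/2} into (2π)^{-1/2}. -/
theorem truncatedBeamConstant_mul (lam ν g : ℝ) :
    truncatedBeamConstant (lam * ν) g * (2 * Real.pi : ℂ) = beamConstant lam ν g := by
  have h : (2 * Real.pi) ^ (-(3 / 2) : ℝ) * (2 * Real.pi) = 1 / √(2 * Real.pi) := by
    have hp : 0 < 2 * Real.pi := by positivity
    rw [← Real.rpow_add_one hp.ne', Real.sqrt_eq_rpow, one_div, ← Real.rpow_neg hp.le]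
    norm_num
  unfold truncatedBeamConstant beamConstant
  rw [← h]
  push_cast
  ring

/-- Moving x to x + tθ multiplies the amplitude by e^{itλν κ·θ}. Fubini on [0, R] × S² then
integrates this phase alone, and homogeneity replaces Q(λνκ) by Q(κ). -/
theorem truncatedBeam_eq {lam ν g : ℝ} (hl : |lam| = 1) (ha : 0 < lam * ν) {μ : Measure S2}
    [IsFiniteMeasure μ] {s : E3 → ℂ} {F : E3 → Fin 3 → ℂ}
    (hF : HasSphericalCurlTransform lam ν g μ s F) (x θ : E3) (R : ℝ) :
    truncatedBeam F θ x R = truncatedBeamConstant (lam * ν) g •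
      ∫ κ : S2, beamKernel (lam * ν * R) ⟪(κ : E3), θ⟫ • mosesAmplitude lam ν s x κ ∂μ := by
  have hA := integrable_mosesAmplitude hl hF.1 x
  have e1 : ∀ t : ℝ, F (x + t • θ) =
      ((1 / (g : ℂ)) * (((2 * Real.pi) ^ (-(3 / 2) : ℝ) : ℝ) : ℂ)) •
        ∫ κ : S2, Complex.exp (Complex.I * ((t * (lam * ν * ⟪(κ : E3), θ⟫) : ℝ) : ℂ)) •
          mosesAmplitude lam ν s x κ ∂μ := by
    intro t
    rw [hF.2, mul_smul, ← integral_smul (((2 * Real.pi) ^ (-(3 / 2) : ℝ) : ℝ) : ℂ)]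
    congr 1
    refine integral_congr_ae (Eventually.of_forall fun κ => ?_)
    simp only
    rw [curlEigenfunction, mosesVector_smul lam ha, planeWave_add_smul, mosesAmplitude]
    simp only [smul_smul]
    congr 1
    ring
  unfold truncatedBeam
  simp only [e1]
  rw [intervalIntegral.integral_smul, intervalIntegral_integral_swap, truncatedBeamConstant,
    mul_smul _ ((lam * ν : ℝ) : ℂ)⁻¹,
    ← integral_smul (((lam * ν : ℝ) : ℂ)⁻¹)]
  · congr 1
    refine integral_congr_ae (Eventually.of_forall fun κ => ?_)
    simp only
    rw [intervalIntegral.integral_smul_const, smul_smul, ← beamKernel_mul ha.ne']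
    rfl
  · have : IsFiniteMeasure (volume.restrict (Set.uIoc 0 R)) := ⟨by simp [Set.uIoc]⟩
    have h1 : Integrable (fun p : ℝ × S2 => mosesAmplitude lam ν s x p.2)
        ((volume.restrict (Set.uIoc 0 R)).prod μ) := hA.comp_snd _
    exact Integrable.bdd_smul h1 1 (Continuous.aestronglyMeasurable (by fun_prop))
      (Eventually.of_forall fun p => (norm_exp_I_mul_ofReal _).le)

/-! ### Hölder regularity of the amplitude and the pointwise formula. -/

section Holder

variable {V : Type*} [NormedAddCommGroup V]

theorem norm_sub_greatCircleIncl_le_of_holderOnWith {θ : E3} (hθ : ‖θ‖ = 1) {G : E3 → V}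
    {C r : ℝ≥0} {δ : ℝ} (hG : HolderOnWith C r G {κ : E3 | ‖κ‖ = 1 ∧ |⟪κ, θ⟫| < δ})
    (p : greatCircle θ × ℝ) (hp : |p.2| < δ) (hp1 : |p.2| < 1) :
    ‖G (spherePoint θ p) - G (greatCircleIncl θ p.1)‖ ≤ C * 2 ^ (r : ℝ) * |p.2| ^ (r : ℝ) := by
  have hδ : 0 < δ := (abs_nonneg _).trans_lt hp
  have h := hG.dist_le_of_le (x := spherePoint θ p) (y := greatCircleIncl θ p.1) (d := 2 * |p.2|)
    ⟨norm_spherePoint hθ p hp1.le, by rwa [inner_spherePoint hθ]⟩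
    ⟨norm_greatCircle θ p.1, by rwa [inner_greatCircle, abs_zero]⟩
    (by rw [dist_eq_norm]; exact norm_spherePoint_sub_le θ hθ p hp1.le)
  rw [dist_eq_norm, Real.mul_rpow (by norm_num) (abs_nonneg _)] at h
  linarith

theorem continuous_greatCircleIncl_of_holderOnWith {θ : E3} {G : E3 → V} {C r : ℝ≥0} (hr : 0 < r)
    {δ : ℝ} (hδ : 0 < δ) (hG : HolderOnWith C r G {κ : E3 | ‖κ‖ = 1 ∧ |⟪κ, θ⟫| < δ}) :
    Continuous fun ω => G (greatCircleIncl θ ω) :=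
  (hG.continuousOn hr).comp_continuous (by fun_prop)
    fun ω => ⟨norm_greatCircle θ ω, by rwa [inner_greatCircle, abs_zero]⟩

theorem integrable_of_continuous_arcLength {θ : E3} {f : greatCircle θ → V} (hf : Continuous f) :
    Integrable f (arcLength θ) :=
  hf.integrable_of_hasCompactSupport (HasCompactSupport.of_compactSpace f)

end Holder

/-- The plane wave is Lipschitz in κ and the other factor is Hölder near the great circle, so their
product has exponent min(r, 1), as |u| < 1. Bounding the product rule also needs a bound M of the
second factor, taken on the compact great circle only. -/
theorem exists_norm_mosesAmplitude_sub_le {θ : E3} (hθ : ‖θ‖ = 1) {lam ν : ℝ} {s : E3 → ℂ}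
    (x : E3) {C r : ℝ≥0} (hr : 0 < r) {δ : ℝ} (hδ : 0 < δ)
    (hG : HolderOnWith C r (fun κ => s ((lam * ν) • κ) • mosesVector lam κ)
      {κ : E3 | ‖κ‖ = 1 ∧ |⟪κ, θ⟫| < δ}) :
    ∃ C' r' : ℝ, 0 ≤ C' ∧ 0 < r' ∧ ∀ p : greatCircle θ × ℝ, |p.2| < δ → |p.2| < 1 →
      ‖mosesAmplitude lam ν s x (spherePoint θ p) -
        mosesAmplitude lam ν s x (greatCircleIncl θ p.1)‖ ≤ C' * |p.2| ^ r' := by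
  set h : E3 → Fin 3 → ℂ := fun κ => s ((lam * ν) • κ) • mosesVector lam κ with hh
  have hA : ∀ κ, mosesAmplitude lam ν s x κ = planeWave ((lam * ν) • κ) x • h κ := fun κ => by
    rw [mosesAmplitude, hh, mul_smul]
  have hc := continuous_greatCircleIncl_of_holderOnWith hr hδ hG
  obtain ⟨M, hM⟩ := isCompact_univ.exists_bound_of_continuousOn hc.continuousOn
  have hr' : (0 : ℝ) < r := by exact_mod_cast hr
  refine ⟨C * 2 ^ (r : ℝ) + |lam * ν| * 2 * ‖x‖ * max M 0, min r 1, by positivity, by positivity,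
    fun p hp hp1 => ?_⟩
  have h1 := norm_sub_greatCircleIncl_le_of_holderOnWith hθ hG p hp hp1
  set P := spherePoint θ p
  set Q := greatCircleIncl θ p.1 with hQ
  have hu := abs_nonneg p.2
  have hrr : |p.2| ^ (r : ℝ) ≤ |p.2| ^ (min (r : ℝ) 1) :=
    Real.rpow_le_rpow_of_exponent_ge_of_imp hu hp1.le (min_le_left _ _)
      fun _ h0 => absurd h0 (by positivity)
  have hr1 : |p.2| ≤ |p.2| ^ (min (r : ℝ) 1) := by
    nth_rewrite 1 [← Real.rpow_one |p.2|]
    exact Real.rpow_le_rpow_of_exponent_ge_of_imp hu hp1.le (min_le_right _ _)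
      fun _ h0 => absurd h0 (by positivity)
  have h2 : ‖planeWave ((lam * ν) • P) x - planeWave ((lam * ν) • Q) x‖ ≤
      |lam * ν| * (2 * |p.2|) * ‖x‖ := by
    refine (norm_planeWave_sub_le _ _ _).trans ?_
    rw [← smul_sub, norm_smul, Real.norm_eq_abs]
    gcongr
    exact norm_spherePoint_sub_le θ hθ p hp1.le
  have h3 : ‖h Q‖ ≤ max M 0 := (hM p.1 (mem_univ _)).trans (le_max_left _ _)
  have e : mosesAmplitude lam ν s x P - mosesAmplitude lam ν s x Q =
      planeWave ((lam * ν) • P) x • (h P - h Q) +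
        (planeWave ((lam * ν) • P) x - planeWave ((lam * ν) • Q) x) • h Q := by
    rw [hA, hA, smul_sub, sub_smul]
    abel
  rw [e]
  refine (norm_add_le _ _).trans ?_
  rw [norm_smul, norm_smul, norm_planeWave, one_mul]
  calc ‖h P - h Q‖ + ‖planeWave ((lam * ν) • P) x - planeWave ((lam * ν) • Q) x‖ * ‖h Q‖
      ≤ C * 2 ^ (r : ℝ) * |p.2| ^ (r : ℝ) + |lam * ν| * (2 * |p.2|) * ‖x‖ * max M 0 := by
        gcongr
    _ = C * 2 ^ (r : ℝ) * |p.2| ^ (r : ℝ) + |lam * ν| * 2 * ‖x‖ * max M 0 * |p.2| := by ring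
    _ ≤ C * 2 ^ (r : ℝ) * |p.2| ^ (min (r : ℝ) 1) +
        |lam * ν| * 2 * ‖x‖ * max M 0 * |p.2| ^ (min (r : ℝ) 1) := by gcongr
    _ = _ := by ring

theorem exists_hasDivergentBeam {lam ν g : ℝ} (hl : |lam| = 1) (ha : 0 < lam * ν)
    {F : E3 → Fin 3 → ℂ} (hFc : Continuous F) {s : E3 → ℂ}
    (hF : HasSphericalCurlTransform lam ν g surfaceMeasure s F) (x : E3) {θ : E3} (hθ : ‖θ‖ = 1)
    {δ : ℝ} (hδ : 0 < δ)
    (hG : IsHolderOn (fun κ => s ((lam * ν) • κ) • mosesVector lam κ)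
      {κ : E3 | ‖κ‖ = 1 ∧ |⟪κ, θ⟫| < δ}) :
    ∃ I : Fin 3 → ℂ, HasHeisenbergIntegral θ (mosesAmplitude lam ν s x) I ∧
      HasDivergentBeam F θ x (beamConstant lam ν g • I) := by
  obtain ⟨C, r, hr, hG⟩ := hG
  obtain ⟨C', r', hC', hr', hH⟩ := exists_norm_mosesAmplitude_sub_le hθ x hr hδ hG
  have hA := integrable_mosesAmplitude hl hF.1 x
  have hcirc : Integrable (fun ω => mosesAmplitude lam ν s x (greatCircleIncl θ ω))
      (arcLength θ) := by
    refine integrable_of_continuous_arcLength ?_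
    have h1 := continuous_greatCircleIncl_of_holderOnWith hr hδ hG
    have h2 : Continuous fun ω : greatCircle θ =>
        planeWave ((lam * ν) • greatCircleIncl θ ω) x :=
      (continuous_planeWave (lam * ν) x).comp (by fun_prop)
    refine (h2.smul h1).congr fun ω => ?_
    rw [mosesAmplitude, mul_smul]
    rfl
  obtain ⟨I, hI, hlim⟩ := exists_hasHeisenbergIntegral_tendsto hθ hA hcirc
    (integrable_latitudeQuotient hθ hr' hC' hδ hA hcirc hH)
  refine ⟨I, hI, fun R => Continuous.intervalIntegrable (by fun_prop) _ _, ?_⟩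
  simp only [truncatedBeam_eq hl ha hF]
  have h3 := (hlim.comp (tendsto_id.const_mul_atTop ha)).const_smul
    (truncatedBeamConstant (lam * ν) g)
  rw [smul_smul, truncatedBeamConstant_mul] at h3
  exact h3

/-! ### The formula weakly in the direction. -/

section Weak

variable {φ : E3 → ℂ}

/-- The average of the kernel against `φ` over all directions. -/
def beamAverage (φ : E3 → ℂ) (T : ℝ) (κ : S2) : ℂ :=
  ∫ θ : S2, beamKernel T ⟪(θ : E3), (κ : E3)⟫ • φ θ ∂surfaceMeasure

theorem IsHolderOn.continuous_sphere (hφ : IsHolderOn φ {θ : E3 | ‖θ‖ = 1}) :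
    Continuous fun θ : S2 => φ θ := by
  obtain ⟨C, r, hr, h⟩ := hφ
  exact (h.continuousOn hr).comp_continuous continuous_subtype_val fun θ => by simp

theorem IsHolderOn.integrable_sphere (hφ : IsHolderOn φ {θ : E3 | ‖θ‖ = 1}) :
    Integrable (fun θ : S2 => φ θ) surfaceMeasure :=
  hφ.continuous_sphere.integrable_of_hasCompactSupport (HasCompactSupport.of_compactSpace _)

/-- The averages of the kernel converge pointwise to the Heisenberg integrals of `φ` and are
uniformly bounded for large times. -/
theorem IsHolderOn.exists_beamAverage_tendsto (hφ : IsHolderOn φ {θ : E3 | ‖θ‖ = 1}) :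
    ∃ Φ : S2 → ℂ, (∀ κ : S2, HasHeisenbergIntegral (κ : E3) φ (Φ κ)) ∧
      (∀ κ, Tendsto (fun T => beamAverage φ T κ) atTop (𝓝 ((2 * Real.pi : ℂ) • Φ κ))) ∧
      ∃ B : ℝ, ∀ᶠ T in atTop, ∀ κ, ‖beamAverage φ T κ‖ ≤ B := by
  have hint := hφ.integrable_sphere
  obtain ⟨M, hM⟩ := isCompact_univ.exists_bound_of_continuousOn hφ.continuous_sphere.continuousOn
  obtain ⟨C, r, hr, h⟩ := hφ
  have hr' : (0 : ℝ) < r := by exact_mod_cast hr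
  have hκ : ∀ κ : S2, ‖(κ : E3)‖ = 1 := fun κ => by simp
  have hG : ∀ κ : S2, HolderOnWith C r φ {θ : E3 | ‖θ‖ = 1 ∧ |⟪θ, (κ : E3)⟫| < 1} :=
    fun κ => h.mono fun θ hθ => hθ.1
  have hcirc : ∀ κ : S2, Integrable (fun ω => φ (greatCircleIncl (κ : E3) ω)) (arcLength κ) :=
    fun κ => integrable_of_continuous_arcLength
      (continuous_greatCircleIncl_of_holderOnWith hr one_pos (hG κ))
  have hH : ∀ κ : S2, ∀ p : greatCircle (κ : E3) × ℝ, |p.2| < 1 →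
      ‖φ (spherePoint κ p) - φ (greatCircleIncl κ p.1)‖ ≤ C * 2 ^ (r : ℝ) * |p.2| ^ (r : ℝ) :=
    fun κ p hp => norm_sub_greatCircleIncl_le_of_holderOnWith (hκ κ) (hG κ) p hp hp
  have hW : ∀ κ : S2, Integrable (latitudeQuotient (κ : E3) φ) (cylinderMeasure κ) := fun κ =>
    integrable_latitudeQuotient (hκ κ) hr' (by positivity) one_pos hint (hcirc κ)
      fun p hp _ => hH κ p hp
  choose Φ hΦ hlim using fun κ : S2 =>
    exists_hasHeisenbergIntegral_tendsto (hκ κ) hint (hcirc κ) (hW κ)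
  set ℓ : ℝ := surfaceMeasure.real (univ : Set S2) / 2 with hℓ
  -- The bound combines the Hölder estimate of the quotient with the length ℓ of a great circle and
  -- sup |φ| ≤ M. The term π + 1 bounds |∫ K_T| for large T, since these integrals tend to π.
  refine ⟨Φ, hΦ, hlim, 2 * (ℓ * (C * 2 ^ (r : ℝ) * ∫ u in Ioo (-1 : ℝ) 1, |u| ^ ((r : ℝ) - 1))) +
    (‖(Real.pi : ℂ)‖ + 1) * (M * ℓ), ?_⟩
  filter_upwards [tendsto_setIntegral_beamKernel.norm.eventually_le_const
    (lt_add_one ‖(Real.pi : ℂ)‖)] with T hT κ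
  refine (norm_integral_beamKernel_inner_smul_le (hκ κ) hint (hcirc κ) (hW κ) T).trans ?_
  have h1 := integral_norm_latitudeQuotient_le hr' (hH κ)
  rw [arcLength_real_univ (hκ κ)] at h1
  have h2 : ‖minkowskiFunk (κ : E3) φ‖ ≤ M * ℓ := by
    rw [hℓ, ← arcLength_real_univ (hκ κ)]
    refine norm_integral_le_of_norm_le_const (Eventually.of_forall fun ω => ?_)
    exact hM ⟨greatCircleIncl κ ω, by simpa using norm_greatCircle (κ : E3) ω⟩ (mem_univ _)
  gcongr

end Weak

/-- The kernel is symmetric in θ and κ, so integrating over θ first leaves `beamAverage φ T κ`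
against the amplitude. Its pointwise limit 2πΦ(κ) and its bound uniform in κ allow dominated
convergence for μ, with no regularity of the amplitude beyond integrability. -/
theorem exists_weak_divergentBeam {lam ν g : ℝ} (hl : |lam| = 1) (ha : 0 < lam * ν)
    {F : E3 → Fin 3 → ℂ} {s : E3 → ℂ} (x : E3) {μ : Measure S2} [IsFiniteMeasure μ]
    (hF : HasSphericalCurlTransform lam ν g μ s F) {φ : E3 → ℂ}
    (hφ : IsHolderOn φ {θ : E3 | ‖θ‖ = 1}) :
    ∃ Φ : S2 → ℂ,
      (∀ κ : S2, HasHeisenbergIntegral (κ : E3) φ (Φ κ)) ∧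
      Integrable (fun κ : S2 => Φ κ • mosesAmplitude lam ν s x κ) μ ∧
      (∀ R : ℝ, Integrable (fun θ : S2 => φ θ • truncatedBeam F θ x R) surfaceMeasure) ∧
      Tendsto (fun R : ℝ => ∫ θ : S2, φ θ • truncatedBeam F θ x R ∂surfaceMeasure) atTop
        (𝓝 (beamConstant lam ν g • ∫ κ : S2, Φ κ • mosesAmplitude lam ν s x κ ∂μ)) := by
  have hA := integrable_mosesAmplitude hl hF.1 x
  set A : S2 → Fin 3 → ℂ := fun κ => mosesAmplitude lam ν s x κ with hAdef
  obtain ⟨Φ, hΦ, hlim, B, hB⟩ := hφ.exists_beamAverage_tendsto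
  have hprod : ∀ T : ℝ, Integrable (fun p : S2 × S2 =>
      beamKernel T ⟪(p.1 : E3), (p.2 : E3)⟫ • φ p.1 • A p.2) (surfaceMeasure.prod μ) := by
    intro T
    refine Integrable.bdd_smul (hφ.integrable_sphere.smul_prod hA) |T| ?_
      (Eventually.of_forall fun p => norm_beamKernel_le T _)
    exact ((continuous_beamKernel T).comp (by fun_prop)).aestronglyMeasurable
  have hinner : ∀ (T : ℝ) (κ : S2), ∫ θ : S2, beamKernel T ⟪(θ : E3), (κ : E3)⟫ • φ θ • A κ
      ∂surfaceMeasure = beamAverage φ T κ • A κ := by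
    intro T κ
    simp only [← smul_assoc]
    rw [integral_smul_const, beamAverage]
  have houter : ∀ (R : ℝ) (θ : S2), φ θ • truncatedBeam F θ x R =
      truncatedBeamConstant (lam * ν) g • ∫ κ : S2,
        beamKernel (lam * ν * R) ⟪(θ : E3), (κ : E3)⟫ • φ θ • A κ ∂μ := by
    intro R θ
    rw [truncatedBeam_eq hl ha hF, smul_comm, ← integral_smul]
    congr 1
    refine integral_congr_ae (Eventually.of_forall fun κ => ?_)
    simp only
    rw [smul_comm, real_inner_comm]
  have havg : ∀ T, Integrable (fun κ => beamAverage φ T κ • A κ) μ := fun T => by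
    have := (hprod T).integral_prod_right
    simpa only [hinner] using this
  have hlimA : ∀ κ, Tendsto (fun T => beamAverage φ T κ • A κ) atTop
      (𝓝 (((2 * Real.pi : ℂ) • Φ κ) • A κ)) := fun κ => (hlim κ).smul_const _
  have hbound : ∀ᶠ T in atTop, ∀ᵐ κ ∂μ, ‖beamAverage φ T κ • A κ‖ ≤ B * ‖A κ‖ := by
    filter_upwards [hB] with T hT
    refine Eventually.of_forall fun κ => ?_
    rw [norm_smul]
    exact mul_le_mul_of_nonneg_right (hT κ) (norm_nonneg _)
  -- Φ was obtained pointwise by choice; measurability of its product with A comes from being a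
  -- limit of the measurable products with `beamAverage`.
  have hint2 : Integrable (fun κ => ((2 * Real.pi : ℂ) • Φ κ) • A κ) μ := by
    refine Integrable.mono' (hA.norm.const_mul B)
      (aestronglyMeasurable_of_tendsto_ae atTop (fun T => (havg T).aestronglyMeasurable)
        (Eventually.of_forall hlimA)) (Eventually.of_forall fun κ => ?_)
    refine le_of_tendsto (hlimA κ).norm ?_
    filter_upwards [hB] with T hT
    rw [norm_smul]
    exact mul_le_mul_of_nonneg_right (hT κ) (norm_nonneg _)
  have hpi : (2 * Real.pi : ℂ) ≠ 0 := by simp [Real.pi_ne_zero]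
  have hint : Integrable (fun κ => Φ κ • A κ) μ := by
    have := hint2.smul (2 * Real.pi : ℂ)⁻¹
    refine this.congr (Eventually.of_forall fun κ => ?_)
    simp only [Pi.smul_apply, smul_assoc, inv_smul_smul₀ hpi]
  refine ⟨Φ, hΦ, hint, fun R => ?_, ?_⟩
  · simp only [houter]
    exact (hprod (lam * ν * R)).integral_prod_left.smul (truncatedBeamConstant (lam * ν) g)
  · have hT := tendsto_integral_filter_of_dominated_convergence (fun κ => B * ‖A κ‖)
      (Eventually.of_forall fun T => (havg T).aestronglyMeasurable) hbound
      (hA.norm.const_mul B) (Eventually.of_forall hlimA)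
    have hT2 := (hT.comp (tendsto_id.const_mul_atTop ha)).const_smul
      (truncatedBeamConstant (lam * ν) g)
    have e : truncatedBeamConstant (lam * ν) g • ∫ κ, ((2 * Real.pi : ℂ) • Φ κ) • A κ ∂μ =
        beamConstant lam ν g • ∫ κ, Φ κ • A κ ∂μ := by
      simp only [smul_assoc]
      rw [integral_smul, smul_smul, truncatedBeamConstant_mul]
    rw [e] at hT2
    refine hT2.congr fun R => ?_
    simp only [houter, Function.comp, id]
    rw [integral_smul, integral_integral_swap (hprod _)]
    simp only [hinner]

end

theorem proposition2 (ν g lam : ℝ) (hν : ν ≠ 0) (hg : g ≠ 0) (hlam : lam = Real.sign ν)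
    (F : E3 → Fin 3 → ℂ) (hF : IsTrkalian ν F) (s : E3 → ℂ) (x : E3) :
    -- pointwise, for a spherical Curl transform that is a function
    (HasSphericalCurlTransform lam ν g surfaceMeasure s F →
      ∀ θ : E3, ‖θ‖ = 1 → ∀ ε : ℝ, 0 < ε →
        IsHolderOn (fun κ => s ((lam * ν) • κ) • mosesVector lam κ)
          {κ : E3 | ‖κ‖ = 1 ∧ |⟪κ, θ⟫| < ε} →
        ∃ I : Fin 3 → ℂ,
          HasHeisenbergIntegral θ (mosesAmplitude lam ν s x) I ∧
          HasDivergentBeam F θ x (beamConstant lam ν g • I)) ∧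
    -- weakly in the direction, for a spherical Curl transform that is a complex measure
    (∀ μ : Measure S2, IsFiniteMeasure μ →
      HasSphericalCurlTransform lam ν g μ s F →
      ∀ φ : E3 → ℂ, IsHolderOn φ {θ : E3 | ‖θ‖ = 1} →
        ∃ Φ : S2 → ℂ,
          (∀ κ : S2, HasHeisenbergIntegral (κ : E3) φ (Φ κ)) ∧
          Integrable (fun κ : S2 => Φ κ • mosesAmplitude lam ν s x κ) μ ∧
          (∀ R : ℝ, Integrable (fun θ : S2 => φ θ • truncatedBeam F θ x R) surfaceMeasure) ∧
          Tendsto (fun R : ℝ => ∫ θ : S2, φ θ • truncatedBeam F θ x R ∂surfaceMeasure) atTop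
            (𝓝 (beamConstant lam ν g •
              ∫ κ : S2, Φ κ • mosesAmplitude lam ν s x κ ∂μ))) := by
  have hl : |lam| = 1 := by
    rw [hlam]
    rcases lt_or_gt_of_ne hν with h | h
    · simp [Real.sign_of_neg h]
    · simp [Real.sign_of_pos h]
  have ha : 0 < lam * ν := by
    rw [hlam]
    rcases lt_or_gt_of_ne hν with h | h
    · rw [Real.sign_of_neg h]; linarith
    · rw [Real.sign_of_pos h]; linarith
  exact ⟨fun hs θ hθ ε hε hG => exists_hasDivergentBeam hl ha hF.1.continuous hs x hθ hε hG,
    fun μ _ hs φ hφ => exists_weak_divergentBeam hl ha x hs hφ⟩
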